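/- **Setting.** Let $L$ be a first-order signature and $Th$ an $L$-theory; $\models\chi$ means that $\chi$ holds in all models of $Th$ under all assignments. A program $\mathcal A$ has $N$ procedures, one of them the main procedure $M$. A procedure $P$ has finite lists of input and output variables (together: its formals $\vec x_P$), finitely many local variables $\vec\ell_P$, and a body $\beta_P$, a quantifier-free formula over $\vec x_P,\vec\ell_P$ in $L$ extended by predicate symbols $\Sigma_Q$ (one for each procedure $Q$, applied to terms), in which the $\Sigma_Q$ occur only positively. The paths of $P$ are the propositional prime implicants of $\beta_P$, as conjunctions of literals written in the order in which their atoms first occur in $\beta_P$. Let $p$ be the maximal number of paths of a procedure and $c$ the maximal number of calls (atoms $\Sigma_Q(\vec a)$) along a path. For a model $I$ of $Th$, $[\![\cdot]\!]_I$ is the least interpretation of the $\Sigma_Q$ with $\beta_Q\Rightarrow\Sigma_Q(\vec x_Q)$ for all $Q$; $[\![P]\!]^b_I$ is the set defined by $\exists\vec\ell_P\,\beta_P$ when each $\Sigma_Q$ is read as $[\![Q]\!]^{b-1}_I$ (as $\emptyset$ if $b=0$). $\mathcal A$ satisfies $\varphi(\vec x_M)$ if $[\![M]\!]_I\subseteq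 I(\varphi)$ for all models $I$ of $Th$. A bounded assertion map $m$ assigns finitely many formulas over $\vec x_P$ to pairs $(P,b)$, non-empty for finitely many pairs only. Let $U_m^b(\Sigma_P)=\bigvee_{b'\le b}m(P,b')$, $O_m^b(\Sigma_P)=\bigwedge_{b'\ge b}m(P,b')$, and let $U_m^{-1},O_m^{-1}$ be constantly $\bot$. Write $\tau_\rho^b$, $\tau_\sigma^b$ for $\tau$ with all $\Sigma_P$ replaced according to $U_\rho^b$, $O_\sigma^b$. **BndSafety**$(\mathcal A,\varphi,n,\rho,\sigma)$ is the following nondeterministic transition system on triples $(\mathcal Q,\rho,\sigma)$, $\mathcal Q$ a set of queries $\langle P,\chi,b\rangle$ ($\chi$ a formula over $\vec x_P$, $b\in\mathbb N$), started with $\mathcal Q=\{\langle M,\neg\varphi,n\rangle\}$. The premises are decided by an oracle for satisfiability modulo $Th$. For $\langle P,\chi,b\rangle\in\mathcal Q$: * *Sum*: if $\models(\beta_P)_\sigma^{b-1}\Rightarrow\neg\chi$, choose $\psi(\vec x_P)$ with $\models(\beta_P)_\sigma^{b-1}\Rightarrow\psi$ and $\models\psi\Rightarrow\neg\chi$, remove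 from $\mathcal Q$ all $\langle P,\eta,c'\rangle$ with $c'\le b$ and $\models O_\sigma^{c'}(\Sigma_P)\wedge\psi\Rightarrow\neg\eta$, and add $\psi$ to $\sigma(P,b)$. * *Reach*: if $\pi$ is a path of $P$ with $\not\models\pi_\rho^{b-1}\Rightarrow\neg\chi$, put $\psi=\exists\vec\ell_P\,\pi_\rho^{b-1}$, remove from $\mathcal Q$ all $\langle P,\eta,c'\rangle$ with $c'\ge b$ and $\not\models\psi\Rightarrow\neg\eta$, and add $\psi$ to $\rho(P,b)$. * *Query* ($b\ge1$): if $\models(\beta_P)_\rho^{b-1}\Rightarrow\neg\chi$, and $\pi_u\wedge\Sigma_R(\vec a)\wedge\pi_v$ is a path of $P$ with $\models(\pi_u)_\sigma^{b-1}\wedge\Sigma_R(\vec a)_\rho^{b-1}\wedge(\pi_v)_\rho^{b-1}\Rightarrow\neg\chi$ and $\not\models(\pi_u)_\sigma^{b-1}\wedge\Sigma_R(\vec a)_\sigma^{b-1}\wedge(\pi_v)_\rho^{b-1}\Rightarrow\neg\chi$, put $\psi(\vec x_R)=\exists\vec y_P\,\bigl((\pi_u)_\sigma^{b-1}\wedge(\pi_v)_\rho^{b-1}\wedge\chi\wedge\vec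 x_R=\vec a\bigr)$, where $\vec y_P$ are the variables of $P$ (renamed apart from $\vec x_R$); if $\models\psi\Rightarrow\neg\eta$ for all $\langle R,\eta,b-1\rangle\in\mathcal Q$, add $\langle R,\psi,b-1\rangle$ to $\mathcal Q$. If $\mathcal Q=\emptyset$, it may return UNSAFE if $\not\models U_\rho^n(\Sigma_M)\Rightarrow\varphi$, and SAFE if $\models O_\sigma^n(\Sigma_M)\Rightarrow\varphi$ (in both cases with the current maps). **RecMC**$(\mathcal A,\varphi)$ starts with $n=0$, $\rho=\sigma=\emptyset$ and repeats: run BndSafety$(\mathcal A,\varphi,n,\rho,\sigma)$, updating $\rho,\sigma$; if the result is UNSAFE, return UNSAFE, $\rho$. Otherwise add every $\delta\in\sigma(P,n)$ with $\models(\beta_P)_\sigma^n\Rightarrow\delta$ to $\sigma(P,n+1)$ (all $P$); if all $\delta\in\sigma(P,n)$ for all $P$ passed this test, return SAFE, $\sigma$; otherwise increase $n$ by $1$. **Theorem.** There is an absolute constant $K$ such that for all $L$, $Th$, $\mathcal A$ and $\varphi(\vec x_M)$ as above: 1. For every $n\ge0$, BndSafety$(\mathcal A,\varphi,n,\emptyset,\emptyset)$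 terminates: it has no infinite execution, and an execution that cannot be continued has returned SAFE or UNSAFE. Moreover, in every execution, (a) for every procedure $P$ and $b\ge 0$, *Reach* infers facts for $P$ at bounds $\le b$ at most $p\,(Np+1)^b$ times; (b) *Query* is applied to a given query $\langle P,\chi,b\rangle$ at most $c\,p\,(Np+1)^b$ times; (c) the number of rule applications spent on a query $\langle P,\chi,b\rangle$, i.e. applied to it or to queries created from it by successive applications of *Query*, is at most $K\,\hat b\,\hat c^{\,b}\,(\widehat{Np})^{K b^2}$, where $\hat k=\max(k,1)$; in short, it is $O(b\,c^b\,(Np)^{O(b^2)})$; (d) the total number of rule applications is at most $K\,\hat n\,\hat c^{\,n}\,(\widehat{Np})^{K n^2}$. 2. RecMC is a co-semidecision procedure for safety: if $\mathcal A$ does not satisfy $\varphi$, then RecMC$(\mathcal A,\varphi)$ has no infinite execution and every execution that cannot be continued has returned UNSAFE. Whenever RecMC returns UNSAFE, $\rho$, there are $b$, $\delta\in\rho(M,b)$, a model $I$ of $Th$ and a tuple $\vec d\in[\![M]\!]^b_I\subseteq[\![M]\!]_I$ with $I\models\delta(\vec d)$ and $I\not\models\varphi(\vec d)$. -/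

import Mathlib

universe u v

namespace RecMC

open FirstOrder FirstOrder.Language

/-! ### Programs in logical form -/

/-- The procedure names of a program together with the numbers of their input and output
parameters.  It determines the fresh predicate symbols `Σ_Q` (one per procedure). -/
structure ProcSig where
  numProcs : ℕ
  numIn : Fin numProcs → ℕ
  numOut : Fin numProcs → ℕ

/-- The formal parameters of a procedure: its input and its output variables. -/
abbrev ProcSig.Formals (S : ProcSig) (P : Fin S.numProcs) : Type :=
  Fin (S.numIn P) ⊕ Fin (S.numOut P)

/-- Atomic formulas over the variables `V` in the signature `L` extended by the predicate symbols
`Σ_Q`; `call Q a` stands for `Σ_Q(a)`. -/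
inductive Atom (L : FirstOrder.Language.{u, v}) (S : ProcSig) (V : Type) : Type (max u v)
  | eq (t₁ t₂ : L.Term V) : Atom L S V
  | rel {k : ℕ} (R : L.Relations k) (ts : Fin k → L.Term V) : Atom L S V
  | call (Q : Fin S.numProcs) (args : S.Formals Q → L.Term V) : Atom L S V

/-- Quantifier-free formulas in the signature `L` extended by the predicate symbols `Σ_Q`. -/
inductive QF (L : FirstOrder.Language.{u, v}) (S : ProcSig) (V : Type) : Type (max u v)
  | falsum : QF L S V
  | atom (a : Atom L S V) : QF L S V
  | neg (f : QF L S V) : QF L S V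
  | and (f g : QF L S V) : QF L S V
  | or (f g : QF L S V) : QF L S V

/-- An environment maps every predicate symbol `Σ_P` to a formula over the formals of `P`. -/
abbrev Env (L : FirstOrder.Language.{u, v}) (S : ProcSig) : Type (max u v) :=
  (P : Fin S.numProcs) → L.Formula (S.Formals P)

/-- An interpretation of the predicate symbols `Σ_P` over the domain `M`. -/
abbrev Interp (S : ProcSig) (M : Type*) : Type _ :=
  (P : Fin S.numProcs) → Set (S.Formals P → M)

section QuantifierFree

variable {L : FirstOrder.Language.{u, v}} {S : ProcSig} {V : Type}

def Atom.IsCall : Atom L S V → Prop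
  | .call _ _ => True
  | _ => False

/-- Truth of an atom in the expansion of the structure `M` that interprets `Σ_Q` by `X Q`. -/
def Atom.Realize {M : Type*} [L.Structure M] (X : Interp S M) (x : V → M) : Atom L S V → Prop
  | .eq t₁ t₂ => t₁.realize x = t₂.realize x
  | .rel R ts => Structure.RelMap R fun i => (ts i).realize x
  | .call Q args => (fun i => (args i).realize x) ∈ X Q

/-- Instantiation of the predicate symbols `Σ_Q` by an environment. -/
def Atom.inst (E : Env L S) : Atom L S V → L.Formula V
  | .eq t₁ t₂ => t₁.equal t₂
  | .rel R ts => R.formula ts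
  | .call Q args => (E Q).subst args

/-- Truth value under an assignment of truth values to the atoms. -/
def QF.eval (w : Atom L S V → Prop) : QF L S V → Prop
  | .falsum => False
  | .atom a => w a
  | .neg f => ¬ f.eval w
  | .and f g => f.eval w ∧ g.eval w
  | .or f g => f.eval w ∨ g.eval w

/-- Satisfaction in the expansion of the structure `M` that interprets `Σ_Q` by `X Q`. -/
def QF.Realize {M : Type*} [L.Structure M] (X : Interp S M) (x : V → M) (f : QF L S V) : Prop :=
  f.eval (Atom.Realize X x)

/-- Instantiation of the predicate symbols `Σ_Q` by an environment. -/
def QF.inst (E : Env L S) : QF L S V → L.Formula V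
  | .falsum => ⊥
  | .atom a => a.inst E
  | .neg f => ∼(f.inst E)
  | .and f g => f.inst E ⊓ g.inst E
  | .or f g => f.inst E ⊔ g.inst E

/-- `f.CallsHavePolarity s`: every occurrence of a predicate symbol `Σ_Q` in `f` is positive
(if `s = true`), or negative (if `s = false`). -/
def QF.CallsHavePolarity : Bool → QF L S V → Prop
  | _, .falsum => True
  | s, .atom a => a.IsCall → s = true
  | s, .neg f => f.CallsHavePolarity (!s)
  | s, .and f g => f.CallsHavePolarity s ∧ g.CallsHavePolarity s
  | s, .or f g => f.CallsHavePolarity s ∧ g.CallsHavePolarity s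

/-- The occurrences of atoms, from left to right. -/
def QF.occurrences : QF L S V → List (Atom L S V)
  | .falsum => []
  | .atom a => [a]
  | .neg f => f.occurrences
  | .and f g => f.occurrences ++ g.occurrences
  | .or f g => f.occurrences ++ g.occurrences

open Classical in
/-- The atoms, without repetition, in the order of their first occurrence. -/
noncomputable def QF.atoms (f : QF L S V) : List (Atom L S V) :=
  f.occurrences.reverse.dedup.reverse

/-- A literal is an atom with a sign. -/
abbrev Literal (L : FirstOrder.Language.{u, v}) (S : ProcSig) (V : Type) : Type (max u v) :=
  Atom L S V × Bool

def Literal.eval (w : Atom L S V → Prop) (l : Literal L S V) : Prop :=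
  if l.2 then w l.1 else ¬ w l.1

def Literal.inst (E : Env L S) (l : Literal L S V) : L.Formula V :=
  if l.2 then l.1.inst E else ∼(l.1.inst E)

/-- Instantiation of a conjunction of literals by an environment. -/
def instConj (E : Env L S) (π : List (Literal L S V)) : L.Formula V :=
  π.foldr (fun l φ => Literal.inst E l ⊓ φ) ⊤

/-- The conjunction of the literals in `π` implies `f` propositionally. -/
def IsImplicant (f : QF L S V) (π : List (Literal L S V)) : Prop :=
  ∀ w : Atom L S V → Prop, (∀ l ∈ π, Literal.eval w l) → f.eval w

/-- `π` is a prime implicant of `f`: a conjunction of literals over pairwise distinct atoms of `f`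
that implies `f` and none of whose proper sub-conjunctions implies `f`.  To make prefixes and
suffixes meaningful, the literals are listed in the order of the atoms of `f`. -/
def IsPrimeImplicant (f : QF L S V) (π : List (Literal L S V)) : Prop :=
  (π.map Prod.fst).Sublist f.atoms ∧ IsImplicant f π ∧
    ∀ π' : List (Literal L S V), π'.Sublist π → π' ≠ π → ¬ IsImplicant f π'

theorem finite_primeImplicants (f : QF L S V) : {π | IsPrimeImplicant f π}.Finite := by
  have key : ∀ as : List (Atom L S V),
      {π : List (Literal L S V) | (π.map Prod.fst).Sublist as}.Finite := by
    intro as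
    induction as with
    | nil => exact (Set.finite_singleton []).subset fun π h => by simpa using h
    | cons a as ih =>
      refine (ih.union ((ih.image (List.cons (a, true))).union
        (ih.image (List.cons (a, false))))).subset ?_
      intro π h
      rcases π with _ | ⟨⟨a', s⟩, π⟩
      · left; simp
      · simp only [Set.mem_ofPred_eq, List.map_cons] at h
        cases h with
        | cons _ h => left; simpa using h
        | cons_cons _ h =>
          right
          cases s
          · right; exact ⟨π, h, rfl⟩
          · left; exact ⟨π, h, rfl⟩
  exact (key f.atoms).subset fun π h => h.1

open Classical in
/-- The number of procedure calls along a path. -/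
noncomputable def numCalls (π : List (Literal L S V)) : ℕ :=
  π.countP fun l => decide l.1.IsCall

end QuantifierFree

/-- A program: a finite list of procedures with a main procedure; each procedure has input and
output parameters, local variables, and a body, which is a quantifier-free formula in which the
predicate symbols `Σ_Q` occur only positively. -/
structure Program (L : FirstOrder.Language.{u, v}) extends ProcSig where
  main : Fin numProcs
  numLocals : Fin numProcs → ℕ
  body : (P : Fin numProcs) → QF L toProcSig (toProcSig.Formals P ⊕ Fin (numLocals P))
  body_positive : ∀ P, (body P).CallsHavePolarity true

namespace Program

variable {L : FirstOrder.Language.{u, v}} (A : Program L)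

abbrev Proc : Type := Fin A.numProcs

abbrev Formals (P : A.Proc) : Type := A.toProcSig.Formals P

abbrev Locals (P : A.Proc) : Type := Fin (A.numLocals P)

abbrev Vars (P : A.Proc) : Type := A.Formals P ⊕ A.Locals P

/-- The paths of a procedure are the prime implicants of its body. -/
noncomputable def paths (P : A.Proc) : Finset (List (Literal L A.toProcSig (A.Vars P))) :=
  (finite_primeImplicants (A.body P)).toFinset

/-- The maximal number of paths in a procedure. -/
noncomputable def maxPaths : ℕ :=
  Finset.univ.sup fun P : A.Proc => (A.paths P).card

/-- The maximal number of procedure calls along a path. -/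
noncomputable def maxCalls : ℕ :=
  Finset.univ.sup fun P : A.Proc => (A.paths P).sup numCalls

/-! ### Semantics -/

section Semantics

variable (M : Type*) [L.Structure M]

/-- The set defined by `∃ locals, body` when `Σ_Q` is interpreted by `X Q`. -/
def bodySet (X : Interp A.toProcSig M) (P : A.Proc) : Set (A.Formals P → M) :=
  {x | ∃ y : A.Locals P → M, (A.body P).Realize X (Sum.elim x y)}

/-- The semantics of the procedures: the pointwise least interpretation that satisfies
`∀ formals locals, body → Σ_Q(formals)` for all `Q`. -/
def sem : Interp A.toProcSig M :=
  sInf {X : Interp A.toProcSig M | ∀ Q, ∀ x : A.Formals Q → M, ∀ y : A.Locals Q → M,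
    (A.body Q).Realize X (Sum.elim x y) → x ∈ X Q}

/-- The semantics with call stack bounded by `b`. -/
def boundedSem : ℕ → Interp A.toProcSig M
  | 0 => A.bodySet M fun _ => ∅
  | b + 1 => A.bodySet M (boundedSem b)

end Semantics

/-- The program satisfies the safety property `φ` modulo the theory `T`. -/
def Satisfies (T : L.Theory) (φ : L.Formula (A.Formals A.main)) : Prop :=
  ∀ I : Theory.ModelType.{u, v, max u v} T, ∀ x : A.Formals A.main → I,
    x ∈ A.sem I A.main → φ.Realize x

/-! ### Bounded assertion maps -/

/-- A triple `⟨P, φ, b⟩` of a procedure, a formula over its formals and a bound. -/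
structure Triple where
  proc : A.Proc
  fml : L.Formula (A.Formals proc)
  bound : ℕ

/-- A (finite) bounded assertion map `m`, as the set of all `⟨P, δ, b⟩` with `δ ∈ m(P, b)`. -/
abbrev AMap : Type (max u v) := Finset A.Triple

variable {A}

theorem AMap.finite_fmls (m : A.AMap) (P : A.Proc) (C : ℕ → Prop) :
    Finite {δ : L.Formula (A.Formals P) // ∃ b, C b ∧ (⟨P, δ, b⟩ : A.Triple) ∈ m} := by
  have h : ((fun δ : L.Formula (A.Formals P) => (⟨P, δ⟩ :
      (P : A.Proc) × L.Formula (A.Formals P))) ⁻¹'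
      ((fun t : A.Triple => (⟨t.proc, t.fml⟩ : (P : A.Proc) × L.Formula (A.Formals P))) ''
        (m : Set A.Triple))).Finite :=
    (m.finite_toSet.image _).preimage fun δ _ δ' _ h => by simpa using h
  have h' : {δ : L.Formula (A.Formals P) | ∃ b, C b ∧ (⟨P, δ, b⟩ : A.Triple) ∈ m}.Finite := by
    refine h.subset ?_
    rintro δ ⟨b, _, hb⟩
    exact ⟨_, hb, rfl⟩
  exact h'.to_subtype

/-- The environment `U_m^b`, mapping `Σ_P` to `⋁ {δ ∈ m(P, b') | b' ≤ b}`. -/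
noncomputable def underEnv (m : A.AMap) (b : ℕ) : Env L A.toProcSig := fun P =>
  haveI := m.finite_fmls P (· ≤ b)
  Formula.iSup fun δ : {δ : L.Formula (A.Formals P) //
    ∃ b', b' ≤ b ∧ (⟨P, δ, b'⟩ : A.Triple) ∈ m} => δ.1

/-- The environment `O_m^b`, mapping `Σ_P` to `⋀ {δ ∈ m(P, b') | b' ≥ b}`. -/
noncomputable def overEnv (m : A.AMap) (b : ℕ) : Env L A.toProcSig := fun P =>
  haveI := m.finite_fmls P (b ≤ ·)
  Formula.iInf fun δ : {δ : L.Formula (A.Formals P) //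
    ∃ b', b ≤ b' ∧ (⟨P, δ, b'⟩ : A.Triple) ∈ m} => δ.1

/-- `U_m^{b-1}`, where `U_m^{-1}` maps every symbol to `⊥`. -/
noncomputable def underEnvPred (m : A.AMap) : ℕ → Env L A.toProcSig
  | 0 => fun _ => ⊥
  | b + 1 => underEnv m b

/-- `O_m^{b-1}`, where `O_m^{-1}` maps every symbol to `⊥`. -/
noncomputable def overEnvPred (m : A.AMap) : ℕ → Env L A.toProcSig
  | 0 => fun _ => ⊥
  | b + 1 => overEnv m b

/-! ### The transition system `BndSafety` -/

/-- The reachability fact `∃ locals, π` obtained from a path with instantiated calls. -/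
noncomputable def reachFact (ρ : A.AMap) (P : A.Proc) (b : ℕ)
    (π : List (Literal L A.toProcSig (A.Vars P))) : L.Formula (A.Formals P) :=
  Formula.iExs (A.Locals P) (instConj (underEnvPred ρ b) π)

/-- The formula of the new query for the callee `R` of the call `Σ_R(a)`: over the formals `z` of
`R` it says that `z = a` and `θ` hold for some values of the variables of the caller `P`.  When `a`
consists of distinct variables, this is `∃` over the remaining variables of `θ`, with `a` renamed
to the formals of `R`. -/
noncomputable def callQuery {P : A.Proc} (R : A.Proc) (a : A.Formals R → L.Term (A.Vars P))
    (θ : L.Formula (A.Vars P)) : L.Formula (A.Formals R) :=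
  Formula.iExs (A.Vars P)
    (θ.relabel Sum.inr ⊓
      Formula.iInf fun i : A.Formals R =>
        (Term.var (Sum.inl i) : L.Term (A.Formals R ⊕ A.Vars P)).equal ((a i).relabel Sum.inr))

variable (A) in
/-- States of `BndSafety`: `running Q ρ σ`, and the two results together with the final maps. -/
inductive State : Type (max u v)
  | running (Q : Set A.Triple) (ρ σ : A.AMap) : State
  | resUnsafe (ρ σ : A.AMap) : State
  | resSafe (ρ σ : A.AMap) : State

def State.IsFinal : A.State → Prop
  | .running _ _ _ => False
  | .resUnsafe _ _ => True
  | .resSafe _ _ => True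

variable (A) in
/-- Rule applications.  `sum q` and `reach q` answer the query `q`, and `query q q'` creates the
query `q'` from the query `q`. -/
inductive RuleApp : Type (max u v)
  | sum (q : A.Triple) : RuleApp
  | reach (q : A.Triple) : RuleApp
  | query (q q' : A.Triple) : RuleApp
  | resUnsafe : RuleApp
  | resSafe : RuleApp

/-- The rule application is an application of a rule to the query `q`. -/
def RuleApp.On (q : A.Triple) : A.RuleApp → Prop
  | .sum q₀ => q₀ = q
  | .reach q₀ => q₀ = q
  | .query q₀ _ => q₀ = q
  | .resUnsafe => False
  | .resSafe => False

/-- The initial state, produced by the rule `Init`. -/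
def init (φ : L.Formula (A.Formals A.main)) (n : ℕ) (ρ σ : A.AMap) : A.State :=
  .running {⟨A.main, ∼φ, n⟩} ρ σ

open Classical in
/-- The rules of `BndSafety` for the safety property `φ` and the bound `n`.  In `sum`, the
interpolant `ψ` may be any formula with the required property.  In `query`, the bound of the
query is positive since the new query has to have a bound in `ℕ`. -/
inductive Step (T : L.Theory) (φ : L.Formula (A.Formals A.main)) (n : ℕ) :
    A.State → A.RuleApp → A.State → Prop
  | sum (Q : Set A.Triple) (ρ σ : A.AMap) (P : A.Proc) (χ : L.Formula (A.Formals P)) (b : ℕ)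
      (ψ : L.Formula (A.Formals P))
      (mem : (⟨P, χ, b⟩ : A.Triple) ∈ Q)
      (blocked : T ⊨ᵇ ((A.body P).inst (overEnvPred σ b)).imp (∼(χ.relabel Sum.inl)))
      (itp_left : T ⊨ᵇ ((A.body P).inst (overEnvPred σ b)).imp (ψ.relabel Sum.inl))
      (itp_right : T ⊨ᵇ ψ.imp (∼χ)) :
      Step T φ n (.running Q ρ σ) (.sum ⟨P, χ, b⟩)
        (.running
          (Q \ {q | ∃ (η : L.Formula (A.Formals P)) (c : ℕ), q = ⟨P, η, c⟩ ∧ c ≤ b ∧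
            T ⊨ᵇ (overEnv σ c P ⊓ ψ).imp (∼η)})
          ρ (insert ⟨P, ψ, b⟩ σ))
  | reach (Q : Set A.Triple) (ρ σ : A.AMap) (P : A.Proc) (χ : L.Formula (A.Formals P)) (b : ℕ)
      (π : List (Literal L A.toProcSig (A.Vars P)))
      (mem : (⟨P, χ, b⟩ : A.Triple) ∈ Q)
      (path : π ∈ A.paths P)
      (feasible : ¬ T ⊨ᵇ (instConj (underEnvPred ρ b) π).imp (∼(χ.relabel Sum.inl))) :
      Step T φ n (.running Q ρ σ) (.reach ⟨P, χ, b⟩)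
        (.running
          (Q \ {q | ∃ (η : L.Formula (A.Formals P)) (c : ℕ), q = ⟨P, η, c⟩ ∧ b ≤ c ∧
            ¬ T ⊨ᵇ (reachFact ρ P b π).imp (∼η)})
          (insert ⟨P, reachFact ρ P b π, b⟩ ρ) σ)
  | query (Q : Set A.Triple) (ρ σ : A.AMap) (P : A.Proc) (χ : L.Formula (A.Formals P)) (b : ℕ)
      (πu πv : List (Literal L A.toProcSig (A.Vars P)))
      (R : A.Proc) (a : A.Formals R → L.Term (A.Vars P)) (ψ : L.Formula (A.Formals R))
      (mem : (⟨P, χ, b + 1⟩ : A.Triple) ∈ Q)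
      (unreached : T ⊨ᵇ ((A.body P).inst (underEnv ρ b)).imp (∼(χ.relabel Sum.inl)))
      (path : πu ++ (Atom.call R a, true) :: πv ∈ A.paths P)
      (under_blocks : T ⊨ᵇ (instConj (overEnv σ b) πu ⊓ (Atom.call R a).inst (underEnv ρ b) ⊓
        instConj (underEnv ρ b) πv).imp (∼(χ.relabel Sum.inl)))
      (over_allows : ¬ T ⊨ᵇ (instConj (overEnv σ b) πu ⊓ (Atom.call R a).inst (overEnv σ b) ⊓
        instConj (underEnv ρ b) πv).imp (∼(χ.relabel Sum.inl)))
      (new_query : ψ = callQuery R a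
        (instConj (overEnv σ b) πu ⊓ instConj (underEnv ρ b) πv ⊓ χ.relabel Sum.inl))
      (no_overlap : ∀ η : L.Formula (A.Formals R), (⟨R, η, b⟩ : A.Triple) ∈ Q →
        T ⊨ᵇ ψ.imp (∼η)) :
      Step T φ n (.running Q ρ σ) (.query ⟨P, χ, b + 1⟩ ⟨R, ψ, b⟩)
        (.running (Q ∪ {⟨R, ψ, b⟩}) ρ σ)
  | resUnsafe (ρ σ : A.AMap)
      (reached : ¬ T ⊨ᵇ (underEnv ρ n A.main).imp φ) :
      Step T φ n (.running ∅ ρ σ) .resUnsafe (.resUnsafe ρ σ)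
  | resSafe (ρ σ : A.AMap)
      (blocked : T ⊨ᵇ (overEnv σ n A.main).imp φ) :
      Step T φ n (.running ∅ ρ σ) .resSafe (.resSafe ρ σ)

/-- `Run T φ n s rs s'`: the rule applications `rs`, in this order, lead from `s` to `s'`. -/
inductive Run (T : L.Theory) (φ : L.Formula (A.Formals A.main)) (n : ℕ) (s : A.State) :
    List A.RuleApp → A.State → Prop
  | nil : Run T φ n s [] s
  | snoc {rs : List A.RuleApp} {s' s'' : A.State} {r : A.RuleApp} :
      Run T φ n s rs s' → Step T φ n s' r s'' → Run T φ n s (rs ++ [r]) s''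

/-- One application of some rule. -/
def BndStep (T : L.Theory) (φ : L.Formula (A.Formals A.main)) (n : ℕ) (s s' : A.State) : Prop :=
  ∃ r, Step T φ n s r s'

open Classical in
/-- The number of applications of `Reach` that update `U_ρ^b` for `Σ_P`, i.e. that infer a
reachability fact for `P` at a bound `b' ≤ b`. -/
noncomputable def numReach (rs : List A.RuleApp) (P : A.Proc) (b : ℕ) : ℕ :=
  rs.countP fun r => decide (∃ q : A.Triple, r = .reach q ∧ q.proc = P ∧ q.bound ≤ b)

open Classical in
/-- The number of applications of `Query` to the query `q`. -/
noncomputable def numQuery (rs : List A.RuleApp) (q : A.Triple) : ℕ :=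
  rs.countP fun r => decide (∃ q', r = .query q q')

/-- `q'` is `q` or was created by successive applications of `Query` starting from `q`. -/
def Descends (rs : List A.RuleApp) (q q' : A.Triple) : Prop :=
  Relation.ReflTransGen (fun q₁ q₂ => RuleApp.query q₁ q₂ ∈ rs) q q'

open Classical in
/-- The number of rule applications spent on answering the query `q`: those applied to `q` or to
a query descending from `q`. -/
noncomputable def work (rs : List A.RuleApp) (q : A.Triple) : ℕ :=
  rs.countP fun r => decide (∃ q', Descends rs q q' ∧ r.On q')

/-! ### The main loop `RecMC` -/

/-- The first result of `CheckInductive`: all summary facts at bound `n` can be pushed. -/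
def IsInductive (T : L.Theory) (σ : A.AMap) (n : ℕ) : Prop :=
  ∀ (P : A.Proc) (δ : L.Formula (A.Formals P)), (⟨P, δ, n⟩ : A.Triple) ∈ σ →
    T ⊨ᵇ ((A.body P).inst (overEnv σ n)).imp (δ.relabel Sum.inl)

open Classical in
/-- The second result of `CheckInductive`: the summary facts at bound `n` that can be pushed are
added at bound `n + 1`.  (Adding them one by one does not change the environment `O_σ^n` in the
test, since they already belong to `σ` at bound `n`.) -/
noncomputable def push (T : L.Theory) (σ : A.AMap) (n : ℕ) : A.AMap :=
  σ ∪ (σ.filter fun t => t.bound = n ∧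
    T ⊨ᵇ ((A.body t.proc).inst (overEnv σ n)).imp (t.fml.relabel Sum.inl)).image
      fun t => ⟨t.proc, t.fml, n + 1⟩

variable (A) in
/-- States of `RecMC`: executing `BndSafety` with bound `n`, or having returned
`UNSAFE, ρ` or `SAFE, σ`. -/
inductive RecState : Type (max u v)
  | bnd (n : ℕ) (s : A.State) : RecState
  | retUnsafe (ρ : A.AMap) : RecState
  | retSafe (σ : A.AMap) : RecState

def RecState.IsUnsafe : A.RecState → Prop
  | .retUnsafe _ => True
  | _ => False

/-- The initial state of `RecMC`: the call of `BndSafety` with bound `0` and empty maps. -/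
def recInit (φ : L.Formula (A.Formals A.main)) : A.RecState :=
  .bnd 0 (init φ 0 ∅ ∅)

/-- The steps of the main loop; a step is a rule application inside the current call of
`BndSafety`, or the treatment of its result. -/
inductive RecStep (T : L.Theory) (φ : L.Formula (A.Formals A.main)) :
    A.RecState → A.RecState → Prop
  | inner (n : ℕ) (s s' : A.State) (h : BndStep T φ n s s') :
      RecStep T φ (.bnd n s) (.bnd n s')
  | retUnsafe (n : ℕ) (ρ σ : A.AMap) :
      RecStep T φ (.bnd n (.resUnsafe ρ σ)) (.retUnsafe ρ)
  | retSafe (n : ℕ) (ρ σ : A.AMap) (h : IsInductive T σ n) :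
      RecStep T φ (.bnd n (.resSafe ρ σ)) (.retSafe (push T σ n))
  | next (n : ℕ) (ρ σ : A.AMap) (h : ¬ IsInductive T σ n) :
      RecStep T φ (.bnd n (.resSafe ρ σ)) (.bnd (n + 1) (init φ (n + 1) ρ (push T σ n)))

end Program

/-- Termination of a nondeterministic transition system started in `s₀`: there is no infinite
execution, and an execution that cannot be continued has ended in a final state. -/
def Terminates {α : Type*} (step : α → α → Prop) (s₀ : α) (final : α → Prop) : Prop :=
  (¬ ∃ s : ℕ → α, s 0 = s₀ ∧ ∀ i, step (s i) (s (i + 1))) ∧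
    ∀ s, Relation.ReflTransGen step s₀ s → (¬ ∃ s', step s s') → final s

end RecMC

/-! An execution of `BndSafety` is controlled by the version of the reachability facts below the
current bound. As long as `U_ρ^{b-1}` stays the same, `Reach` is applied to each path at bound `b`
at most once, since a fact already inferred excludes every query it meets, and `Query` is applied to
each call on each path at most once for a given query. As only `Reach` at bounds below `b` changes
`U_ρ^{b-1}`, this bounds the applications of `Reach` by recursion on `b`, and then those of `Query`.
A query is answered at most once, and the queries created from it have the next smaller bound, so
the work spent on it satisfies a recursion as well, which yields termination.

An open query of least bound always admits a rule: if neither `Sum` nor `Reach` applies, then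
replacing the under-approximations along a path by over-approximations one literal at a time
identifies a call to which `Query` applies.

Facts in `ρ` always underapproximate and facts in `σ` overapproximate the bounded semantics, whose
supremum is the least fixed point. A counterexample therefore has some bound `b`, and `BndSafety`
cannot return `SAFE` at `b`, so that `RecMC` runs `BndSafety` only finitely often. -/

namespace RecMC

open FirstOrder FirstOrder.Language

theorem countP_eq_card_filter_range {α : Type*} (p : α → Bool) (l : List α) :
    l.countP p = ((Finset.range l.length).filter fun i => l[i]?.any p).card := by
  induction l using List.reverseRecOn with
  | nil => simp
  | append_singleton l a ih =>
    have hinit : (Finset.range l.length).filter (fun i => (l ++ [a])[i]?.any p) =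
        (Finset.range l.length).filter fun i => l[i]?.any p :=
      Finset.filter_congr fun i hi => by
        rw [List.getElem?_append_left (Finset.mem_range.1 hi)]
    rw [List.countP_append, List.length_append, List.length_singleton, Finset.range_add_one,
      Finset.filter_insert, hinit, ih]
    by_cases ha : p a <;> simp [ha]

theorem countP_le_card_of_forall_subsingleton {α κ : Type*} {p : α → Bool} {l : List α}
    {K : Finset κ} (key : ℕ → κ → Prop)
    (hkey : ∀ i a, l[i]? = some a → p a → ∃ k ∈ K, key i k)
    (hinj : ∀ i j k, i < j → j < l.length → key i k → ¬ key j k) : l.countP p ≤ K.card := by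
  rw [countP_eq_card_filter_range]
  refine Finset.card_le_card_of_forall_subsingleton key (fun i hi => ?_) fun k _ i hi j hj => ?_
  · obtain ⟨a, ha, hp⟩ := (Option.any_eq_true ..).1 (Finset.mem_filter.1 hi).2
    exact hkey i a ha hp
  · have hlt {i : ℕ} (hi : i ∈ (Finset.range l.length).filter fun i => l[i]?.any p) :
        i < l.length := Finset.mem_range.1 (Finset.mem_filter.1 hi).1
    rcases lt_trichotomy i j with hij | hij | hij
    · exact absurd hj.2 (hinj i j k hij (hlt hj.1) hi.2)
    · exact hij
    · exact absurd hi.2 (hinj j i k hij (hlt hi.1) hj.2)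

theorem countP_le_sum_countP {α ι : Type*} (l : List α) (s : Finset ι) (p : α → Bool)
    (f : ι → α → Bool) (h : ∀ x ∈ l, p x → ∃ i ∈ s, f i x) :
    l.countP p ≤ ∑ i ∈ s, l.countP (f i) := by
  induction l with
  | nil => simp
  | cons x l ih =>
    simp only [List.countP_cons, Finset.sum_add_distrib]
    refine Nat.add_le_add (ih fun y hy => h y (List.mem_cons_of_mem _ hy)) ?_
    split_ifs with hp
    · obtain ⟨i, hi, hf⟩ := h x List.mem_cons_self hp
      refine (by simp [hf] : 1 ≤ if f i x then 1 else 0).trans ?_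
      exact Finset.single_le_sum (f := fun i => if f i x then 1 else 0)
        (fun _ _ => Nat.zero_le _) hi
    · exact Nat.zero_le _

theorem countP_le_add_countP {α : Type*} (l : List α) (p p₁ p₂ : α → Bool)
    (h : ∀ x ∈ l, p x → p₁ x ∨ p₂ x) : l.countP p ≤ l.countP p₁ + l.countP p₂ := by
  have hle := countP_le_sum_countP l Finset.univ p (fun i : Bool => if i then p₁ else p₂)
    fun x hx hp => by simpa [or_comm] using h x hx hp
  simpa [Fintype.sum_bool] using hle

section QuantifierFree

variable {L : FirstOrder.Language.{u, v}} {S : ProcSig} {V : Type}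

theorem models_imp_iff {T : L.Theory} {α β : L.Formula V} :
    T ⊨ᵇ α.imp β ↔
      ∀ (I : Theory.ModelType.{u, v, max u v} T) (x : V → I), α.Realize x → β.Realize x := by
  simp only [Theory.models_formula_iff, Formula.realize_imp]

theorem models_imp_not_iff {T : L.Theory} {α β : L.Formula V} :
    T ⊨ᵇ α.imp (∼β) ↔
      ∀ (I : Theory.ModelType.{u, v, max u v} T) (x : V → I), α.Realize x → ¬ β.Realize x := by
  simp only [models_imp_iff, Formula.realize_not]

theorem not_models_imp_not_iff {T : L.Theory} {α β : L.Formula V} :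
    ¬ T ⊨ᵇ α.imp (∼β) ↔
      ∃ (I : Theory.ModelType.{u, v, max u v} T) (x : V → I), α.Realize x ∧ β.Realize x := by
  simp only [models_imp_not_iff, not_forall, not_not, exists_prop]

variable {M : Type*} [L.Structure M]

/-- The interpretation of the predicate symbols defined by an environment. -/
def Env.interp (E : Env L S) (M : Type*) [L.Structure M] : Interp S M :=
  fun P => {y | (E P).Realize y}

/-- Truth of a conjunction of literals in the expansion of `M` that interprets `Σ_Q` by `X Q`. -/
def ConjRealize (X : Interp S M) (x : V → M) (π : List (Literal L S V)) : Prop :=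
  ∀ l ∈ π, Literal.eval (Atom.Realize X x) l

@[simp]
theorem conjRealize_nil (X : Interp S M) (x : V → M) :
    ConjRealize X x ([] : List (Literal L S V)) := by
  simp [ConjRealize]

@[simp]
theorem conjRealize_cons (X : Interp S M) (x : V → M) (l : Literal L S V)
    (π : List (Literal L S V)) :
    ConjRealize X x (l :: π) ↔ Literal.eval (Atom.Realize X x) l ∧ ConjRealize X x π := by
  simp [ConjRealize]

@[simp]
theorem conjRealize_append (X : Interp S M) (x : V → M) (π π' : List (Literal L S V)) :
    ConjRealize X x (π ++ π') ↔ ConjRealize X x π ∧ ConjRealize X x π' := by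
  simp [ConjRealize, or_imp, forall_and]

theorem Atom.realize_inst (E : Env L S) (a : Atom L S V) (x : V → M) :
    (a.inst E).Realize x ↔ a.Realize (E.interp M) x := by
  cases a with
  | eq t₁ t₂ => simp [Atom.inst, Atom.Realize]
  | rel R ts => simp [Atom.inst, Atom.Realize]
  | call Q args => exact BoundedFormula.realize_subst

theorem QF.realize_inst (E : Env L S) (f : QF L S V) (x : V → M) :
    (f.inst E).Realize x ↔ f.Realize (E.interp M) x := by
  induction f with
  | falsum => simp [QF.inst, QF.Realize, QF.eval]
  | atom a => exact a.realize_inst E x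
  | neg f ih => simpa [QF.inst, QF.Realize, QF.eval] using not_congr ih
  | and f g ihf ihg => simpa [QF.inst, QF.Realize, QF.eval] using and_congr ihf ihg
  | or f g ihf ihg => simpa [QF.inst, QF.Realize, QF.eval] using or_congr ihf ihg

theorem Literal.realize_inst (E : Env L S) (l : Literal L S V) (x : V → M) :
    (Literal.inst E l).Realize x ↔ Literal.eval (Atom.Realize (E.interp M) x) l := by
  unfold Literal.inst Literal.eval
  split
  · exact l.1.realize_inst E x
  · exact not_congr (l.1.realize_inst E x)

theorem realize_instConj (E : Env L S) (π : List (Literal L S V)) (x : V → M) :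
    (instConj E π).Realize x ↔ ConjRealize (E.interp M) x π := by
  induction π with
  | nil => simp [instConj]
  | cons l π ih =>
    rw [conjRealize_cons, ← ih, ← Literal.realize_inst]
    simp [instConj]

/-! ### Monotonicity and continuity in the predicate symbols -/

theorem Atom.realize_congr_of_not_isCall {a : Atom L S V} (ha : ¬ a.IsCall) (X Y : Interp S M)
    (x : V → M) : a.Realize X x ↔ a.Realize Y x := by
  cases a with
  | call Q args => exact absurd trivial ha
  | _ => rfl

theorem Atom.realize_mono (a : Atom L S V) (x : V → M) :
    Monotone fun X : Interp S M => a.Realize X x := by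
  intro X Y h
  cases a with
  | call Q args => exact fun hx => h Q hx
  | _ => exact le_rfl

theorem Atom.exists_realize_of_realize_iSup {ι : Type*} [Nonempty ι] {X : ι → Interp S M}
    {a : Atom L S V} {x : V → M} (ha : a.Realize (⨆ i, X i) x) : ∃ i, a.Realize (X i) x := by
  cases a with
  | call Q args => simpa [Atom.Realize] using ha
  | _ => exact ⟨Classical.arbitrary ι, ha⟩

theorem QF.eval_congr {w w' : Atom L S V → Prop} {f : QF L S V}
    (h : ∀ a ∈ f.occurrences, (w a ↔ w' a)) : f.eval w ↔ f.eval w' := by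
  induction f with
  | falsum => rfl
  | atom a => exact h a (by simp [QF.occurrences])
  | neg f ih => exact not_congr (ih h)
  | and f g ihf ihg =>
    simp only [QF.occurrences, List.mem_append, or_imp, forall_and] at h
    exact and_congr (ihf h.1) (ihg h.2)
  | or f g ihf ihg =>
    simp only [QF.occurrences, List.mem_append, or_imp, forall_and] at h
    exact or_congr (ihf h.1) (ihg h.2)

theorem QF.eval_mono_and_anti {w w' : Atom L S V → Prop} {f : QF L S V}
    (h : ∀ a ∈ f.occurrences, w a → w' a) (h' : ∀ a ∈ f.occurrences, ¬ a.IsCall → w' a → w a) :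
    (f.CallsHavePolarity true → f.eval w → f.eval w') ∧
      (f.CallsHavePolarity false → f.eval w' → f.eval w) := by
  induction f with
  | falsum => exact ⟨fun _ => id, fun _ => id⟩
  | atom a =>
    have ha : a ∈ (QF.atom a).occurrences := by simp [QF.occurrences]
    exact ⟨fun _ => h a ha, fun hp => h' a ha fun hc => Bool.false_ne_true (hp hc)⟩
  | neg f ih => exact ⟨fun hp => mt ((ih h h').2 hp), fun hp => mt ((ih h h').1 hp)⟩
  | and f g ihf ihg =>
    simp only [QF.occurrences, List.mem_append, or_imp, forall_and] at h h'
    exact ⟨fun hp => And.imp ((ihf h.1 h'.1).1 hp.1) ((ihg h.2 h'.2).1 hp.2),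
      fun hp => And.imp ((ihf h.1 h'.1).2 hp.1) ((ihg h.2 h'.2).2 hp.2)⟩
  | or f g ihf ihg =>
    simp only [QF.occurrences, List.mem_append, or_imp, forall_and] at h h'
    exact ⟨fun hp => Or.imp ((ihf h.1 h'.1).1 hp.1) ((ihg h.2 h'.2).1 hp.2),
      fun hp => Or.imp ((ihf h.1 h'.1).2 hp.1) ((ihg h.2 h'.2).2 hp.2)⟩

theorem QF.eval_mono {w w' : Atom L S V → Prop} {f : QF L S V} (hf : f.CallsHavePolarity true)
    (h : ∀ a ∈ f.occurrences, w a → w' a) (h' : ∀ a ∈ f.occurrences, ¬ a.IsCall → w' a → w a)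
    (hw : f.eval w) : f.eval w' :=
  (QF.eval_mono_and_anti h h').1 hf hw

theorem QF.realize_mono {f : QF L S V} (hf : f.CallsHavePolarity true) (x : V → M) :
    Monotone fun X : Interp S M => f.Realize X x :=
  fun X Y h => QF.eval_mono hf (fun a _ => a.realize_mono x h)
    fun _ _ ha => (Atom.realize_congr_of_not_isCall ha X Y x).2

theorem QF.realize_iSup_iff {ι : Type*} [Nonempty ι] {X : ι → Interp S M}
    (hX : Directed (· ≤ ·) X) {f : QF L S V} (hf : f.CallsHavePolarity true) {x : V → M} :
    f.Realize (⨆ i, X i) x ↔ ∃ i, f.Realize (X i) x := by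
  classical
  refine ⟨fun hx => ?_, fun ⟨i, hx⟩ => QF.realize_mono hf x (le_iSup X i) hx⟩
  have hatom (a : Atom L S V) : ∃ i, a.Realize (⨆ i, X i) x → a.Realize (X i) x := by
    by_cases ha : a.Realize (⨆ i, X i) x
    · exact (Atom.exists_realize_of_realize_iSup ha).imp fun _ hi _ => hi
    · exact ⟨Classical.arbitrary ι, fun h => absurd h ha⟩
  choose i hi using hatom
  obtain ⟨k, hk⟩ := hX.finset_le (f.occurrences.map i).toFinset
  refine ⟨k, QF.eval_mono hf (fun a ha h => ?_)
    (fun _ _ ha => (Atom.realize_congr_of_not_isCall ha _ _ x).2) hx⟩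
  exact a.realize_mono x (hk (i a) (List.mem_toFinset.2 (List.mem_map_of_mem ha))) (hi a h)

theorem conjRealize_mono {π : List (Literal L S V)} (hπ : ∀ l ∈ π, l.1.IsCall → l.2 = true)
    (x : V → M) : Monotone fun X : Interp S M => ConjRealize X x π := by
  intro X Y h hx l hl
  have hl' := hx l hl
  unfold Literal.eval at hl' ⊢
  by_cases hc : l.1.IsCall
  · simp only [hπ l hl hc, if_true] at hl' ⊢
    exact l.1.realize_mono x h hl'
  · rwa [Atom.realize_congr_of_not_isCall hc X Y x] at hl'

theorem Literal.eval_realize_congr_of_not_isCall {l : Literal L S V} (hl : ¬ l.1.IsCall)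
    (X Y : Interp S M) (x : V → M) :
    Literal.eval (Atom.Realize X x) l ↔ Literal.eval (Atom.Realize Y x) l := by
  unfold Literal.eval
  rw [Atom.realize_congr_of_not_isCall hl X Y x]

theorem conjRealize_congr_of_not_isCall {π : List (Literal L S V)} (hπ : ∀ l ∈ π, ¬ l.1.IsCall)
    (X Y : Interp S M) (x : V → M) : ConjRealize X x π ↔ ConjRealize Y x π :=
  forall₂_congr fun l hl => Literal.eval_realize_congr_of_not_isCall (hπ l hl) X Y x

/-! ### Prime implicants -/

theorem QF.mem_atoms {f : QF L S V} {a : Atom L S V} : a ∈ f.atoms ↔ a ∈ f.occurrences := by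
  classical
  simp [QF.atoms]

theorem QF.nodup_atoms (f : QF L S V) : f.atoms.Nodup := by
  classical
  simpa [QF.atoms] using List.nodup_dedup f.occurrences.reverse

theorem exists_primeImplicant {f : QF L S V} {w : Atom L S V → Prop} (hw : f.eval w) :
    ∃ π, IsPrimeImplicant f π ∧ ∀ l ∈ π, Literal.eval w l := by
  classical
  let π₀ : List (Literal L S V) := f.atoms.map fun a => (a, decide (w a))
  have hπ₀ : IsImplicant f π₀ := by
    intro w' hw'
    refine (QF.eval_congr fun a ha => ?_).1 hw
    have := hw' (a, decide (w a)) (List.mem_map.2 ⟨a, QF.mem_atoms.2 ha, rfl⟩)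
    by_cases h : w a <;> simpa [Literal.eval, h] using this
  obtain ⟨π, ⟨hsub, himp⟩, hmin⟩ := (InvImage.wf List.length wellFounded_lt).has_min
    {π | π.Sublist π₀ ∧ IsImplicant f π} ⟨π₀, List.Sublist.refl _, hπ₀⟩
  refine ⟨π, ⟨?_, himp, fun π' hπ' hne himp' => ?_⟩, fun l hl => ?_⟩
  · simpa [π₀, Function.comp_def] using hsub.map Prod.fst
  · exact hmin π' ⟨hπ'.trans hsub, himp'⟩
      (hπ'.length_le.lt_of_ne fun h => hne (hπ'.eq_of_length h))
  · obtain ⟨a, -, rfl⟩ := List.mem_map.1 (hsub.subset hl)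
    by_cases h : w a <;> simp [Literal.eval, h]

theorem IsPrimeImplicant.nodup {f : QF L S V} {π : List (Literal L S V)}
    (hπ : IsPrimeImplicant f π) : (π.map Prod.fst).Nodup :=
  hπ.1.nodup f.nodup_atoms

-- A negative call could be dropped from `π`: making the call false makes `f` true, and since calls
-- are positive in `f`, it stays true when the call becomes true.
theorem IsPrimeImplicant.call_pos {f : QF L S V} {π : List (Literal L S V)}
    (hπ : IsPrimeImplicant f π) (hf : f.CallsHavePolarity true) {l : Literal L S V}
    (hl : l ∈ π) (hcall : l.1.IsCall) : l.2 = true := by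
  by_contra hneg
  obtain ⟨a, s⟩ := l
  obtain rfl : s = false := by simpa using hneg
  obtain ⟨π₁, π₂, rfl⟩ := List.append_of_mem hl
  have hother : ∀ l ∈ π₁ ++ π₂, l.1 ≠ a := by
    rintro l hmem rfl
    have hnodup := hπ.nodup
    rw [List.map_append, List.map_cons, List.nodup_middle, List.nodup_cons] at hnodup
    exact hnodup.1 (by simpa only [List.map_append] using List.mem_map_of_mem (f := Prod.fst) hmem)
  refine hπ.2.2 (π₁ ++ π₂) (by simp) (fun h => by simpa using congrArg List.length h)
    fun w hw => ?_
  let w' : Atom L S V → Prop := fun a' => a' ≠ a ∧ w a'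
  have hw' : f.eval w' := by
    refine hπ.2.1 w' fun l hl => ?_
    obtain rfl | hl : l = (a, false) ∨ l ∈ π₁ ++ π₂ := by
      simpa only [List.mem_append, List.mem_cons, or_left_comm] using hl
    · simp [Literal.eval, w']
    · simpa [Literal.eval, w', hother l hl] using hw l hl
  refine QF.eval_mono hf (fun _ _ h => h.2) (fun a' _ ha' h => ⟨?_, h⟩) hw'
  rintro rfl
  exact ha' hcall

end QuantifierFree

namespace Program

variable {L : FirstOrder.Language.{u, v}} {A : Program L}

/-! ### Assertion maps -/

theorem mem_paths {P : A.Proc} {π : List (Literal L A.toProcSig (A.Vars P))} :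
    π ∈ A.paths P ↔ IsPrimeImplicant (A.body P) π := by
  simp [paths]

theorem card_paths_le (P : A.Proc) : (A.paths P).card ≤ A.maxPaths :=
  Finset.le_sup (f := fun P : A.Proc => (A.paths P).card) (Finset.mem_univ P)

theorem call_pos_of_mem_paths {P : A.Proc} {π : List (Literal L A.toProcSig (A.Vars P))}
    (hπ : π ∈ A.paths P) : ∀ l ∈ π, l.1.IsCall → l.2 = true :=
  fun _ hl hc => (mem_paths.1 hπ).call_pos (A.body_positive P) hl hc

section Environments

variable {M : Type*} [L.Structure M]

theorem body_realize_iff {P : A.Proc} {X : Interp A.toProcSig M} {x : A.Vars P → M} :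
    (A.body P).Realize X x ↔ ∃ π ∈ A.paths P, ConjRealize X x π := by
  constructor
  · intro hx
    obtain ⟨π, hπ, hπx⟩ := exists_primeImplicant hx
    exact ⟨π, mem_paths.2 hπ, hπx⟩
  · rintro ⟨π, hπ, hπx⟩
    exact (mem_paths.1 hπ).2.1 _ hπx

theorem mem_underEnv {m : A.AMap} {b : ℕ} {P : A.Proc} {y : A.Formals P → M} :
    y ∈ (underEnv m b).interp M P ↔
      ∃ δ b', b' ≤ b ∧ (⟨P, δ, b'⟩ : A.Triple) ∈ m ∧ δ.Realize y := by
  have := m.finite_fmls P (· ≤ b)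
  refine Formula.realize_iSup.trans ?_
  simp only [Subtype.exists]
  exact ⟨fun ⟨δ, ⟨b', hb', h⟩, hy⟩ => ⟨δ, b', hb', h, hy⟩,
    fun ⟨δ, b', hb', h, hy⟩ => ⟨δ, ⟨b', hb', h⟩, hy⟩⟩

theorem mem_overEnv {m : A.AMap} {b : ℕ} {P : A.Proc} {y : A.Formals P → M} :
    y ∈ (overEnv m b).interp M P ↔
      ∀ δ b', b ≤ b' → (⟨P, δ, b'⟩ : A.Triple) ∈ m → δ.Realize y := by
  have := m.finite_fmls P (b ≤ ·)
  refine Formula.realize_iInf.trans ?_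
  simp only [Subtype.forall]
  exact ⟨fun H δ b' hb' h => H δ ⟨b', hb', h⟩, fun H δ ⟨b', hb', h⟩ => H δ b' hb' h⟩

theorem mem_underEnvPred {m : A.AMap} {b : ℕ} {P : A.Proc} {y : A.Formals P → M} :
    y ∈ (underEnvPred m b).interp M P ↔
      ∃ δ b', b' < b ∧ (⟨P, δ, b'⟩ : A.Triple) ∈ m ∧ δ.Realize y := by
  cases b with
  | zero => simp [underEnvPred, Env.interp]
  | succ b => exact mem_underEnv.trans (by simp only [Nat.lt_succ_iff])

theorem interp_underEnv_mono {m m' : A.AMap} {b b' : ℕ} (h : m ⊆ m') (hb : b ≤ b') :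
    (underEnv m b).interp M ≤ (underEnv m' b').interp M := by
  intro P y hy
  obtain ⟨δ, c, hc, hδ, hr⟩ := mem_underEnv.1 hy
  exact mem_underEnv.2 ⟨δ, c, hc.trans hb, h hδ, hr⟩

theorem interp_overEnv_anti {m m' : A.AMap} {b b' : ℕ} (h : m ⊆ m') (hb : b ≤ b') :
    (overEnv m' b).interp M ≤ (overEnv m b').interp M :=
  fun _ _ hy => mem_overEnv.2 fun δ c hc hδ => mem_overEnv.1 hy δ c (hb.trans hc) (h hδ)

theorem interp_underEnvPred_congr {m m' : A.AMap} {b : ℕ}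
    (h : ∀ t : A.Triple, t.bound < b → (t ∈ m ↔ t ∈ m')) :
    (underEnvPred m b).interp M = (underEnvPred m' b).interp M := by
  funext P
  ext y
  simp only [mem_underEnvPred]
  exact exists₂_congr fun δ b' => and_congr_right fun hb' => and_congr_left' (h _ hb')

theorem realize_relabel_inl {P : A.Proc} {χ : L.Formula (A.Formals P)} {x : A.Vars P → M} :
    (χ.relabel (Sum.inl : A.Formals P → A.Vars P)).Realize x ↔ χ.Realize (x ∘ Sum.inl) :=
  Formula.realize_relabel

theorem realize_reachFact {ρ : A.AMap} {P : A.Proc} {b : ℕ}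
    {π : List (Literal L A.toProcSig (A.Vars P))} {x : A.Formals P → M} :
    (reachFact ρ P b π).Realize x ↔
      ∃ y : A.Locals P → M, ConjRealize ((underEnvPred ρ b).interp M) (Sum.elim x y) π := by
  simp only [reachFact, Formula.realize_iExs, realize_instConj]

theorem realize_callQuery {P R : A.Proc} {a : A.Formals R → L.Term (A.Vars P)}
    {θ : L.Formula (A.Vars P)} {z : A.Formals R → M} :
    (callQuery R a θ).Realize z ↔
      ∃ x : A.Vars P → M, θ.Realize x ∧ z = fun i => (a i).realize x := by
  unfold callQuery
  rw [Formula.realize_iExs]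
  simp [Formula.realize_relabel, funext_iff]

end Environments

/-! ### Answered queries -/

/-- The reachability facts in `ρ` do not meet the query `q`. -/
def Unreached (T : L.Theory) (ρ : A.AMap) (q : A.Triple) : Prop :=
  ∀ (I : Theory.ModelType.{u, v, max u v} T), ∀ x ∈ (underEnv ρ q.bound).interp I q.proc,
    ¬ q.fml.Realize x

/-- The summary facts in `σ` exclude the query `q`. -/
def Blocked (T : L.Theory) (σ : A.AMap) (q : A.Triple) : Prop :=
  ∀ (I : Theory.ModelType.{u, v, max u v} T), ∀ x ∈ (overEnv σ q.bound).interp I q.proc,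
    ¬ q.fml.Realize x

/-- The maps `ρ` and `σ` answer the query `q`, negatively or positively. -/
def Answered (T : L.Theory) (ρ σ : A.AMap) (q : A.Triple) : Prop :=
  Blocked T σ q ∨ ¬ Unreached T ρ q

theorem Unreached.anti {T : L.Theory} {ρ ρ' : A.AMap} (h : ρ ⊆ ρ') {q : A.Triple}
    (hq : Unreached T ρ' q) : Unreached T ρ q :=
  fun I x hx => hq I x (interp_underEnv_mono h le_rfl _ hx)

theorem Blocked.mono {T : L.Theory} {σ σ' : A.AMap} (h : σ ⊆ σ') {q : A.Triple}
    (hq : Blocked T σ q) : Blocked T σ' q :=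
  fun I x hx => hq I x (interp_overEnv_anti h le_rfl _ hx)

theorem Answered.mono {T : L.Theory} {ρ ρ' σ σ' : A.AMap} (hρ : ρ ⊆ ρ') (hσ : σ ⊆ σ')
    {q : A.Triple} (hq : Answered T ρ σ q) : Answered T ρ' σ' q :=
  hq.imp (Blocked.mono hσ) fun h h' => h (h'.anti hρ)

section Insert

variable {T : L.Theory} {ρ σ : A.AMap} {P : A.Proc} {b : ℕ}

open Classical in
theorem blocked_insert_of_models {ψ η : L.Formula (A.Formals P)} {c : ℕ} (hc : c ≤ b)
    (h : T ⊨ᵇ (overEnv σ c P ⊓ ψ).imp (∼η)) :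
    Blocked T (insert (⟨P, ψ, b⟩ : A.Triple) σ) ⟨P, η, c⟩ := by
  intro I x hx
  refine models_imp_not_iff.1 h I x (Formula.realize_inf.2 ⟨?_, ?_⟩)
  · exact interp_overEnv_anti (Finset.subset_insert _ _) le_rfl P hx
  · exact mem_overEnv.1 hx ψ b hc (Finset.mem_insert_self _ _)

open Classical in
theorem not_unreached_insert_of_not_models {ψ η : L.Formula (A.Formals P)} {c : ℕ} (hc : b ≤ c)
    (h : ¬ T ⊨ᵇ ψ.imp (∼η)) :
    ¬ Unreached T (insert (⟨P, ψ, b⟩ : A.Triple) ρ) ⟨P, η, c⟩ := by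
  obtain ⟨I, x, hψ, hη⟩ := not_models_imp_not_iff.1 h
  exact fun hu => hu I x (mem_underEnv.2 ⟨ψ, b, hc, Finset.mem_insert_self _ _, hψ⟩) hη

open Classical in
theorem unreached_insert {ψ : L.Formula (A.Formals P)} {q : A.Triple} (hq : Unreached T ρ q)
    (h : ∀ η c, q = ⟨P, η, c⟩ → b ≤ c → T ⊨ᵇ ψ.imp (∼η)) :
    Unreached T (insert (⟨P, ψ, b⟩ : A.Triple) ρ) q := by
  intro I x hx
  obtain ⟨δ, b', hb', hδ, hr⟩ := mem_underEnv.1 hx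
  rcases Finset.mem_insert.1 hδ with he | hδ
  · obtain ⟨R, η, c⟩ := q
    cases he
    exact models_imp_not_iff.1 (h η c rfl hb') I x hr
  · exact hq I x (mem_underEnv.2 ⟨δ, b', hb', hδ, hr⟩)

end Insert

/-! ### Call sites -/

/-- A decomposition `πu ∧ Σ_R(a) ∧ πv` of a conjunction of literals over the variables of `P`: an
occurrence of a call, together with its context. -/
structure CallSite (P : A.Proc) where
  pre : List (Literal L A.toProcSig (A.Vars P))
  callee : A.Proc
  args : A.Formals callee → L.Term (A.Vars P)
  post : List (Literal L A.toProcSig (A.Vars P))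

namespace CallSite

variable {P : A.Proc}

/-- The conjunction `πu ∧ Σ_R(a) ∧ πv` that contains the call. -/
def path (c : A.CallSite P) : List (Literal L A.toProcSig (A.Vars P)) :=
  c.pre ++ (Atom.call c.callee c.args, true) :: c.post

/-- The query for the callee that `Query` derives from the query `⟨P, χ, b + 1⟩`. -/
noncomputable def subquery (c : A.CallSite P) (ρ σ : A.AMap) (χ : L.Formula (A.Formals P))
    (b : ℕ) : A.Triple :=
  ⟨c.callee, callQuery c.callee c.args
    (instConj (overEnv σ b) c.pre ⊓ instConj (underEnv ρ b) c.post ⊓ χ.relabel Sum.inl), b⟩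

theorem path_getElem? (c : A.CallSite P) :
    c.path[c.pre.length]? = some (Atom.call c.callee c.args, true) := by
  simp [path]

theorem eq_of_path_eq_of_length_eq {c c' : A.CallSite P} (h : c.path = c'.path)
    (h' : c.pre.length = c'.pre.length) : c = c' := by
  obtain ⟨hpre, hpost⟩ := List.append_inj h h'
  obtain ⟨_, _, _, _⟩ := c
  obtain ⟨_, _, _, _⟩ := c'
  simp_all

theorem realize_subquery {M : Type*} [L.Structure M] {c : A.CallSite P} {ρ σ : A.AMap}
    {χ : L.Formula (A.Formals P)} {b : ℕ} {z : A.Formals c.callee → M} :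
    (c.subquery ρ σ χ b).fml.Realize z ↔ ∃ x : A.Vars P → M,
      ConjRealize ((overEnv σ b).interp M) x c.pre ∧
        ConjRealize ((underEnv ρ b).interp M) x c.post ∧
          χ.Realize (x ∘ Sum.inl) ∧ z = fun i => (c.args i).realize x := by
  unfold subquery
  simp only [realize_callQuery, Formula.realize_inf, realize_instConj, realize_relabel_inl,
    and_assoc]

end CallSite

open Classical in
/-- The pairs of a path of `P` and the position of a call on it. -/
noncomputable def callPositions (P : A.Proc) :
    Finset ((_ : List (Literal L A.toProcSig (A.Vars P))) × ℕ) :=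
  (A.paths P).sigma fun π =>
    (Finset.range π.length).filter fun k => π[k]?.any fun l => decide l.1.IsCall

theorem card_callPositions_le (P : A.Proc) :
    (callPositions P).card ≤ A.maxPaths * A.maxCalls := by
  classical
  have hcalls (π) (hπ : π ∈ A.paths P) : ((Finset.range π.length).filter
      fun k => π[k]?.any fun l => decide l.1.IsCall).card ≤ A.maxCalls := by
    have hle : numCalls π ≤ A.maxCalls := (Finset.le_sup (f := numCalls) hπ).trans
      (Finset.le_sup (f := fun P => (A.paths P).sup numCalls) (Finset.mem_univ P))
    rwa [numCalls, countP_eq_card_filter_range] at hle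
  calc (callPositions P).card
      ≤ ∑ _π ∈ A.paths P, A.maxCalls := by
        rw [callPositions, Finset.card_sigma]
        exact Finset.sum_le_sum hcalls
    _ = (A.paths P).card * A.maxCalls := by simp
    _ ≤ A.maxPaths * A.maxCalls := Nat.mul_le_mul_right _ (card_paths_le P)

theorem CallSite.mem_callPositions {P : A.Proc} {c : A.CallSite P} (hc : c.path ∈ A.paths P) :
    (⟨c.path, c.pre.length⟩ : (_ : List (Literal L A.toProcSig (A.Vars P))) × ℕ) ∈
      callPositions P := by
  classical
  refine Finset.mem_sigma.2 ⟨hc, Finset.mem_filter.2 ⟨?_, ?_⟩⟩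
  · simp [CallSite.path]
  · rw [c.path_getElem?]
    exact decide_eq_true trivial

section SubqueryPremises

variable {T : L.Theory} {ρ σ : A.AMap} {P : A.Proc} {χ : L.Formula (A.Formals P)} {b : ℕ}

theorem CallSite.realize_subquery_mono {ρ' σ' : A.AMap} {c : A.CallSite P}
    (hc : c.path ∈ A.paths P) {M : Type*} [L.Structure M]
    (hρ : (underEnv ρ b).interp M ≤ (underEnv ρ' b).interp M)
    (hσ : (overEnv σ b).interp M ≤ (overEnv σ' b).interp M) {z : A.Formals c.callee → M}
    (hz : (c.subquery ρ σ χ b).fml.Realize z) : (c.subquery ρ' σ' χ b).fml.Realize z := by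
  have hpos := call_pos_of_mem_paths hc
  simp only [CallSite.path, List.mem_append, List.mem_cons, or_imp, forall_and] at hpos
  obtain ⟨x, hu, hv, hχz⟩ := CallSite.realize_subquery.1 hz
  exact CallSite.realize_subquery.2
    ⟨x, conjRealize_mono hpos.1 x hσ hu, conjRealize_mono hpos.2.2 x hρ hv, hχz⟩

/-- The formula `(πu)_σ^b ∧ (πv)_ρ^b ∧ χ` is satisfiable modulo `T`. -/
def MixedSat (T : L.Theory) (ρ σ : A.AMap) (χ : L.Formula (A.Formals P)) (b : ℕ)
    (πu πv : List (Literal L A.toProcSig (A.Vars P))) : Prop :=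
  ∃ (I : Theory.ModelType.{u, v, max u v} T) (x : A.Vars P → I),
    ConjRealize ((overEnv σ b).interp I) x πu ∧ ConjRealize ((underEnv ρ b).interp I) x πv ∧
      χ.Realize (x ∘ Sum.inl)

theorem CallSite.unreached_subquery_iff {c : A.CallSite P} :
    Unreached T ρ (c.subquery ρ σ χ b) ↔
      ¬ MixedSat T ρ σ χ b c.pre ((Atom.call c.callee c.args, true) :: c.post) := by
  constructor
  · rintro h ⟨I, x, hu, hv, hχ⟩
    rw [conjRealize_cons] at hv
    exact h I _ hv.1 (CallSite.realize_subquery.2 ⟨x, hu, hv.2, hχ, rfl⟩)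
  · rintro h I _ hz hfml
    obtain ⟨x, hu, hv, hχ, rfl⟩ := CallSite.realize_subquery.1 hfml
    exact h ⟨I, x, hu, (conjRealize_cons ..).2 ⟨hz, hv⟩, hχ⟩

theorem CallSite.not_blocked_subquery_iff {c : A.CallSite P} :
    ¬ Blocked T σ (c.subquery ρ σ χ b) ↔
      MixedSat T ρ σ χ b (c.pre ++ [(Atom.call c.callee c.args, true)]) c.post := by
  rw [← not_iff_not, not_not]
  constructor
  · rintro h ⟨I, x, hu, hv, hχ⟩
    rw [conjRealize_append, conjRealize_cons] at hu
    exact h I _ hu.2.1 (CallSite.realize_subquery.2 ⟨x, hu.1, hv, hχ, rfl⟩)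
  · rintro h I _ hz hfml
    obtain ⟨x, hu, hv, hχ, rfl⟩ := CallSite.realize_subquery.1 hfml
    refine h ⟨I, x, (conjRealize_append ..).2 ⟨hu, ?_⟩, hv, hχ⟩
    exact (conjRealize_cons ..).2 ⟨hz, conjRealize_nil _ _⟩

theorem not_models_mixed_iff {πu πv : List (Literal L A.toProcSig (A.Vars P))} {R : A.Proc}
    {a : A.Formals R → L.Term (A.Vars P)} {E : Env L A.toProcSig} :
    ¬ T ⊨ᵇ (instConj (overEnv σ b) πu ⊓ (Atom.call R a).inst E ⊓
        instConj (underEnv ρ b) πv).imp (∼(χ.relabel (Sum.inl : A.Formals P → A.Vars P))) ↔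
      ∃ (I : Theory.ModelType.{u, v, max u v} T) (x : A.Vars P → I),
        (ConjRealize ((overEnv σ b).interp I) x πu ∧ (Atom.call R a).Realize (E.interp I) x) ∧
          ConjRealize ((underEnv ρ b).interp I) x πv ∧ χ.Realize (x ∘ Sum.inl) := by
  simp only [not_models_imp_not_iff, Formula.realize_inf, realize_instConj, Atom.realize_inst,
    realize_relabel_inl, and_assoc]

theorem CallSite.under_blocks_iff {c : A.CallSite P} :
    T ⊨ᵇ (instConj (overEnv σ b) c.pre ⊓ (Atom.call c.callee c.args).inst (underEnv ρ b) ⊓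
        instConj (underEnv ρ b) c.post).imp
          (∼(χ.relabel (Sum.inl : A.Formals P → A.Vars P))) ↔
      Unreached T ρ (c.subquery ρ σ χ b) := by
  rw [CallSite.unreached_subquery_iff, ← not_iff_not, not_not, not_models_mixed_iff]
  simp [MixedSat, Literal.eval, and_assoc]

theorem CallSite.over_allows_iff {c : A.CallSite P} :
    ¬ T ⊨ᵇ (instConj (overEnv σ b) c.pre ⊓ (Atom.call c.callee c.args).inst (overEnv σ b) ⊓
        instConj (underEnv ρ b) c.post).imp
          (∼(χ.relabel (Sum.inl : A.Formals P → A.Vars P))) ↔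
      ¬ Blocked T σ (c.subquery ρ σ χ b) := by
  rw [CallSite.not_blocked_subquery_iff, not_models_mixed_iff]
  simp [MixedSat, Literal.eval, and_assoc]

theorem not_models_reachFact_iff {π : List (Literal L A.toProcSig (A.Vars P))} :
    ¬ T ⊨ᵇ (reachFact ρ P b π).imp (∼χ) ↔
      ¬ T ⊨ᵇ (instConj (underEnvPred ρ b) π).imp
        (∼(χ.relabel (Sum.inl : A.Formals P → A.Vars P))) := by
  simp only [not_models_imp_not_iff, realize_reachFact, realize_instConj, realize_relabel_inl]
  constructor
  · rintro ⟨I, x, ⟨y, hy⟩, hx⟩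
    exact ⟨I, Sum.elim x y, hy, by simpa using hx⟩
  · rintro ⟨I, x, hπ, hx⟩
    exact ⟨I, x ∘ Sum.inl, ⟨x ∘ Sum.inr, by simpa using hπ⟩, hx⟩

end SubqueryPremises

/-! ### Rule applications -/

/-- The open queries of a state; none is open once a result has been returned. -/
def State.queries : A.State → Set A.Triple
  | .running Q _ _ => Q
  | .resUnsafe _ _ => ∅
  | .resSafe _ _ => ∅

/-- The reachability facts `ρ` of a state. -/
def State.under : A.State → A.AMap
  | .running _ ρ _ => ρ
  | .resUnsafe ρ _ => ρ
  | .resSafe ρ _ => ρ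

/-- The summary facts `σ` of a state. -/
def State.over : A.State → A.AMap
  | .running _ _ σ => σ
  | .resUnsafe _ σ => σ
  | .resSafe _ σ => σ

namespace Step

variable {T : L.Theory} {φ : L.Formula (A.Formals A.main)} {n : ℕ} {s s' : A.State}
  {r : A.RuleApp} {q q' : A.Triple}

theorem under_subset (h : Step T φ n s r s') : s.under ⊆ s'.under := by
  classical
  cases h with
  | reach => exact Finset.subset_insert _ _
  | _ => exact Finset.Subset.refl _

theorem over_subset (h : Step T φ n s r s') : s.over ⊆ s'.over := by
  classical
  cases h with
  | sum => exact Finset.subset_insert _ _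
  | _ => exact Finset.Subset.refl _

theorem mem_under_or (h : Step T φ n s r s') {t : A.Triple} (ht : t ∈ s'.under) :
    t ∈ s.under ∨ ∃ q, r = .reach q ∧ t.bound = q.bound := by
  classical
  cases h with
  | reach _ _ _ P χ b =>
    rcases Finset.mem_insert.1 ht with rfl | ht
    · exact .inr ⟨_, rfl, rfl⟩
    · exact .inl ht
  | _ => exact .inl ht

theorem mem_queries_of_on (h : Step T φ n s r s') (hr : r.On q) : q ∈ s.queries := by
  cases h with
  | sum _ _ _ _ _ _ _ mem => exact hr ▸ mem
  | reach _ _ _ _ _ _ _ mem => exact hr ▸ mem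
  | query _ _ _ _ _ _ _ _ _ _ _ mem => exact hr ▸ mem
  | _ => exact hr.elim

theorem mem_queries_or_created (h : Step T φ n s r s') (hq : q ∈ s'.queries) :
    q ∈ s.queries ∨ ∃ q₀, r = .query q₀ q := by
  cases h with
  | sum => exact .inl hq.1
  | reach => exact .inl hq.1
  | query => exact hq.imp_right fun hq => ⟨_, congrArg _ hq.symm⟩
  | _ => exact hq.elim

theorem mem_queries_or_answered (h : Step T φ n s r s') (hq : q ∈ s.queries) :
    q ∈ s'.queries ∨ Answered T s'.under s'.over q := by
  refine or_iff_not_imp_left.2 fun hq' => ?_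
  cases h with
  | sum =>
    obtain ⟨η, c, rfl, hc, hη⟩ := not_not.1 fun h => hq' ⟨hq, h⟩
    exact .inl (blocked_insert_of_models hc hη)
  | reach =>
    obtain ⟨η, c, rfl, hc, hη⟩ := not_not.1 fun h => hq' ⟨hq, h⟩
    exact .inr (not_unreached_insert_of_not_models hc hη)
  | query => exact absurd (.inl hq) hq'
  | _ => exact hq.elim

theorem notMem_queries_of_sum (h : Step T φ n s (.sum q) s') : q ∉ s'.queries := by
  cases h with
  | sum _ _ _ _ _ _ _ _ _ _ itp_right =>
    refine fun hq => hq.2 ⟨_, _, rfl, le_rfl, ?_⟩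
    exact models_imp_iff.2 fun I x hx =>
      models_imp_iff.1 itp_right I x (Formula.realize_inf.1 hx).2

theorem notMem_queries_of_reach (h : Step T φ n s (.reach q) s') : q ∉ s'.queries := by
  cases h with
  | reach _ _ _ _ _ _ _ _ _ feasible =>
    exact fun hq => hq.2 ⟨_, _, rfl, le_rfl, not_models_reachFact_iff.2 feasible⟩

theorem exists_path (h : Step T φ n s (.reach q) s') :
    ∃ π ∈ A.paths q.proc, ¬ T ⊨ᵇ (reachFact s.under q.proc q.bound π).imp (∼q.fml) ∧
      ⟨q.proc, reachFact s.under q.proc q.bound π, q.bound⟩ ∈ s'.under := by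
  classical
  cases h with
  | reach _ _ _ _ _ _ π _ path feasible =>
    exact ⟨π, path, not_models_reachFact_iff.2 feasible, Finset.mem_insert_self _ _⟩

theorem exists_callSite (h : Step T φ n s (.query q q') s') :
    ∃ (c : A.CallSite q.proc) (b : ℕ), c.path ∈ A.paths q.proc ∧ q.bound = b + 1 ∧
      q' = c.subquery s.under s.over q.fml b := by
  cases h with
  | query _ _ _ _ _ b πu πv R a _ _ _ path _ _ new_query =>
    subst new_query
    exact ⟨⟨πu, R, a, πv⟩, b, path, rfl, rfl⟩

theorem models_imp_not_of_query (h : Step T φ n s (.query q q') s')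
    {η : L.Formula (A.Formals q'.proc)} (hη : ⟨q'.proc, η, q'.bound⟩ ∈ s.queries) :
    T ⊨ᵇ q'.fml.imp (∼η) := by
  cases h with
  | query _ _ _ _ _ _ _ _ _ _ _ _ _ _ _ _ _ no_overlap => exact no_overlap η hη

theorem mem_queries_of_query (h : Step T φ n s (.query q q') s') : q' ∈ s'.queries := by
  cases h with
  | query => exact .inr rfl

theorem not_answered_of_query (h : Step T φ n s (.query q q') s') :
    ¬ Answered T s.under s.over q' := by
  cases h with
  | query _ _ _ _ _ b πu πv R a _ _ _ _ under_blocks over_allows new_query =>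
    subst new_query
    have hu := (CallSite.under_blocks_iff (c := ⟨πu, R, a, πv⟩)).1 under_blocks
    have ho := (CallSite.over_allows_iff (c := ⟨πu, R, a, πv⟩)).1 over_allows
    exact not_or.2 ⟨ho, not_not.2 hu⟩

theorem unreached (h : Step T φ n s r s') (hs : ∀ q ∈ s.queries, Unreached T s.under q) :
    ∀ q ∈ s'.queries, Unreached T s'.under q := by
  intro q hq
  rcases h.mem_queries_or_created hq with hq₀ | ⟨q₀, rfl⟩
  · cases h with
    | reach =>
      refine unreached_insert (hs q hq₀) fun η c hqc hc => not_not.1 fun hη => ?_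
      exact hq.2 ⟨η, c, hqc, hc, hη⟩
    | _ => exact hs q hq₀
  · have hu := not_not.1 (not_or.1 h.not_answered_of_query).2
    cases h with
    | query => exact hu

end Step

/-! ### Deadlock freedom -/

theorem exists_switch {α : Type*} {good : List α → List α → Prop} {l : List α} :
    ∀ {l₀ : List α}, ¬ good l₀ l → good (l₀ ++ l) [] →
      ∃ u a v, l₀ ++ l = u ++ a :: v ∧ ¬ good u (a :: v) ∧ good (u ++ [a]) v := by
  induction l with
  | nil => exact fun h h' => absurd (by simpa using h') h
  | cons a l ih =>
    intro l₀ h h'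
    by_cases hgood : good (l₀ ++ [a]) l
    · exact ⟨l₀, a, l, rfl, h, hgood⟩
    · simpa using ih hgood (by simpa using h')

section DeadlockFreedom

variable {T : L.Theory} {ρ σ : A.AMap} {P : A.Proc} {χ : L.Formula (A.Formals P)} {b : ℕ}

theorem MixedSat.cons_of_append_of_not_isCall {πu πv : List (Literal L A.toProcSig (A.Vars P))}
    {l : Literal L A.toProcSig (A.Vars P)} (hl : ¬ l.1.IsCall)
    (h : MixedSat T ρ σ χ b (πu ++ [l]) πv) : MixedSat T ρ σ χ b πu (l :: πv) := by
  obtain ⟨I, x, hu, hv, hχ⟩ := h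
  rw [conjRealize_append, conjRealize_cons] at hu
  have hlx := (Literal.eval_realize_congr_of_not_isCall hl _ ((underEnv ρ b).interp I) x).1 hu.2.1
  exact ⟨I, x, hu.1, (conjRealize_cons ..).2 ⟨hlx, hv⟩, hχ⟩

-- Replace the under-approximations along a path by over-approximations, from left to right: the
-- path becomes compatible with `χ` at some literal, and this literal is a call.
theorem exists_callSite_of_mixedSat {π : List (Literal L A.toProcSig (A.Vars P))}
    (hπ : π ∈ A.paths P) (hunder : ¬ MixedSat T ρ σ χ b [] π) (hover : MixedSat T ρ σ χ b π []) :
    ∃ c : A.CallSite P, c.path = π ∧ Unreached T ρ (c.subquery ρ σ χ b) ∧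
      ¬ Blocked T σ (c.subquery ρ σ χ b) := by
  obtain ⟨πu, l, πv, rfl, hno, hyes⟩ := exists_switch hunder hover
  have hcall : l.1.IsCall := not_not.1 fun hl => hno (hyes.cons_of_append_of_not_isCall hl)
  have hpos : l.2 = true := call_pos_of_mem_paths hπ l (by simp) hcall
  obtain ⟨⟨_, _⟩ | ⟨_, _⟩ | ⟨R, a⟩, sign⟩ := l
  · exact hcall.elim
  · exact hcall.elim
  · obtain rfl : sign = true := hpos
    exact ⟨⟨πu, R, a, πv⟩, rfl, CallSite.unreached_subquery_iff.2 hno,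
      CallSite.not_blocked_subquery_iff.2 hyes⟩

theorem models_body_underEnvPred_iff :
    T ⊨ᵇ ((A.body P).inst (underEnvPred ρ b)).imp (∼(χ.relabel Sum.inl)) ↔
      ∀ π ∈ A.paths P, T ⊨ᵇ (instConj (underEnvPred ρ b) π).imp (∼(χ.relabel Sum.inl)) := by
  simp only [models_imp_not_iff, QF.realize_inst, realize_instConj, body_realize_iff]
  exact ⟨fun h π hπ I x hx => h I x ⟨π, hπ, hx⟩, fun h I x ⟨π, hπ, hx⟩ => h π hπ I x hx⟩

theorem exists_callSite_of_models
    (hunder : T ⊨ᵇ ((A.body P).inst (underEnv ρ b)).imp (∼(χ.relabel Sum.inl)))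
    (hover : ¬ T ⊨ᵇ ((A.body P).inst (overEnv σ b)).imp (∼(χ.relabel Sum.inl))) :
    ∃ c : A.CallSite P, c.path ∈ A.paths P ∧ Unreached T ρ (c.subquery ρ σ χ b) ∧
      ¬ Blocked T σ (c.subquery ρ σ χ b) := by
  obtain ⟨I, x, hbody, hχ⟩ := not_models_imp_not_iff.1 hover
  rw [QF.realize_inst] at hbody
  obtain ⟨π, hπ, hx⟩ := body_realize_iff.1 hbody
  have hunderπ : ¬ MixedSat T ρ σ χ b [] π := by
    rintro ⟨I, x, -, hx, hχ⟩
    refine models_imp_not_iff.1 hunder I x ?_ (realize_relabel_inl.2 hχ)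
    exact (QF.realize_inst ..).2 (body_realize_iff.2 ⟨π, hπ, hx⟩)
  obtain ⟨c, rfl, hc⟩ := exists_callSite_of_mixedSat hπ hunderπ
    ⟨I, x, hx, conjRealize_nil _ _, realize_relabel_inl.1 hχ⟩
  exact ⟨c, hπ, hc⟩

end DeadlockFreedom

section DeadlockFreedom

variable {T : L.Theory} {φ : L.Formula (A.Formals A.main)} {n : ℕ} {Q : Set A.Triple}
  {ρ σ : A.AMap} {P : A.Proc} {χ : L.Formula (A.Formals P)} {b : ℕ}

theorem exists_sum_step (hq : ⟨P, χ, b⟩ ∈ Q)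
    (h : T ⊨ᵇ ((A.body P).inst (overEnvPred σ b)).imp (∼(χ.relabel Sum.inl))) :
    ∃ s', BndStep T φ n (.running Q ρ σ) s' := by
  refine ⟨_, _, Step.sum Q ρ σ P χ b (∼χ) hq h ?_ (models_imp_iff.2 fun _ _ => id)⟩
  rw [models_imp_not_iff] at h
  refine models_imp_iff.2 fun I x hx => ?_
  exact realize_relabel_inl.2 (mt realize_relabel_inl.2 (h I x hx))

theorem exists_query_step (hq : ⟨P, χ, b + 1⟩ ∈ Q) (hmin : ∀ q ∈ Q, b < q.bound)
    (hunder : T ⊨ᵇ ((A.body P).inst (underEnv ρ b)).imp (∼(χ.relabel Sum.inl)))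
    (hover : ¬ T ⊨ᵇ ((A.body P).inst (overEnv σ b)).imp (∼(χ.relabel Sum.inl))) :
    ∃ s', BndStep T φ n (.running Q ρ σ) s' := by
  obtain ⟨c, hc, hunreached, hblocked⟩ := exists_callSite_of_models hunder hover
  exact ⟨_, _, Step.query Q ρ σ P χ b c.pre c.post c.callee c.args _ hq hunder hc
    (CallSite.under_blocks_iff.2 hunreached) (CallSite.over_allows_iff.2 hblocked) rfl
    fun η hη => absurd (hmin _ hη) (lt_irrefl b)⟩

theorem exists_step_of_nonempty (hQ : Q.Nonempty) :
    ∃ s', BndStep T φ n (.running Q ρ σ) s' := by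
  obtain ⟨⟨P, χ, b⟩, hq, hmin⟩ := (InvImage.wf Triple.bound wellFounded_lt).has_min Q hQ
  by_cases hover : T ⊨ᵇ ((A.body P).inst (overEnvPred σ b)).imp (∼(χ.relabel Sum.inl))
  · exact exists_sum_step hq hover
  by_cases hunder : T ⊨ᵇ ((A.body P).inst (underEnvPred ρ b)).imp (∼(χ.relabel Sum.inl))
  · cases b with
    | zero => exact absurd hunder hover
    | succ b =>
      exact exists_query_step hq (fun q hq => Nat.lt_of_succ_le (not_lt.1 (hmin q hq))) hunder hover
  · rw [models_body_underEnvPred_iff] at hunder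
    push Not at hunder
    obtain ⟨π, hπ, hfeasible⟩ := hunder
    exact ⟨_, _, Step.reach Q ρ σ P χ b π hq hπ hfeasible⟩

end DeadlockFreedom

/-! ### Traces -/

section Traces

variable {T : L.Theory} {φ : L.Formula (A.Formals A.main)} {n : ℕ} {f : ℕ → A.State}
  {rs : List A.RuleApp} {i j : ℕ}

/-- The states `f 0, f 1, …` passed through by the rule applications `rs`, starting from a state
in which no open query is met by a reachability fact. Only the first `rs.length + 1` states
matter. -/
structure IsTrace (T : L.Theory) (φ : L.Formula (A.Formals A.main)) (n : ℕ) (f : ℕ → A.State)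
    (rs : List A.RuleApp) : Prop where
  step : ∀ {i : ℕ} {r : A.RuleApp}, rs[i]? = some r → Step T φ n (f i) r (f (i + 1))
  unreached_zero : ∀ q ∈ (f 0).queries, Unreached T (f 0).under q

theorem Run.exists_isTrace {s s' : A.State} (h : Run T φ n s rs s')
    (hs : ∀ q ∈ s.queries, Unreached T s.under q) :
    ∃ f, f 0 = s ∧ f rs.length = s' ∧ IsTrace T φ n f rs := by
  induction h with
  | nil => exact ⟨fun _ => s, rfl, rfl, by simp, hs⟩
  | @snoc rs s' s'' r _ hstep ih =>
    obtain ⟨f, rfl, rfl, hf⟩ := ih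
    have hlt {i : ℕ} (hi : i ≤ rs.length) :
        Function.update f (rs.length + 1) s'' i = f i :=
      Function.update_of_ne (by omega) _ _
    refine ⟨Function.update f (rs.length + 1) s'', hlt (Nat.zero_le _), by simp, ?_,
      by simpa only [hlt (Nat.zero_le _)] using hs⟩
    intro i r' hr'
    rcases lt_trichotomy i rs.length with hi | rfl | hi
    · rw [List.getElem?_append_left hi] at hr'
      rw [hlt hi.le, hlt hi]
      exact hf.step hr'
    · obtain rfl : r = r' := by simpa using hr'
      rw [hlt le_rfl, Function.update_self]
      exact hstep
    · rw [List.getElem?_eq_none (by simpa using hi)] at hr'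
      exact absurd hr' (by simp)

namespace IsTrace

theorem preserves (h : IsTrace T φ n f rs) {C : A.State → Prop}
    (hC : ∀ {s s' r}, Step T φ n s r s' → C s → C s') (hij : i ≤ j) (hj : j ≤ rs.length)
    (hi : C (f i)) : C (f j) := by
  induction j, hij using Nat.le_induction with
  | base => exact hi
  | succ j _ ih => exact hC (h.step (List.getElem?_eq_getElem hj)) (ih (Nat.le_of_lt hj))

theorem under_subset (h : IsTrace T φ n f rs) (hij : i ≤ j) (hj : j ≤ rs.length) :
    (f i).under ⊆ (f j).under :=
  h.preserves (C := fun s => (f i).under ⊆ s.under) (fun hs hsub => hsub.trans hs.under_subset)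
    hij hj subset_rfl

theorem over_subset (h : IsTrace T φ n f rs) (hij : i ≤ j) (hj : j ≤ rs.length) :
    (f i).over ⊆ (f j).over :=
  h.preserves (C := fun s => (f i).over ⊆ s.over) (fun hs hsub => hsub.trans hs.over_subset)
    hij hj subset_rfl

theorem unreached (h : IsTrace T φ n f rs) (hj : j ≤ rs.length) :
    ∀ q ∈ (f j).queries, Unreached T (f j).under q :=
  h.preserves (C := fun s => ∀ q ∈ s.queries, Unreached T s.under q) Step.unreached
    (Nat.zero_le _) hj h.unreached_zero

theorem mem_queries_or_answered (h : IsTrace T φ n f rs) (hij : i ≤ j) (hj : j ≤ rs.length)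
    {q : A.Triple} (hq : q ∈ (f i).queries) :
    q ∈ (f j).queries ∨ Answered T (f j).under (f j).over q :=
  h.preserves (C := fun s => q ∈ s.queries ∨ Answered T s.under s.over q)
    (fun hs hq => hq.elim hs.mem_queries_or_answered
      fun ha => .inr (ha.mono hs.under_subset hs.over_subset))
    hij hj (.inl hq)

theorem notMem_queries_of_answered (h : IsTrace T φ n f rs) (hij : i ≤ j) (hj : j ≤ rs.length)
    {q : A.Triple} (ha : Answered T (f i).under (f i).over q) (hq : q ∉ (f i).queries) :
    q ∉ (f j).queries := by
  refine (h.preserves (C := fun s => Answered T s.under s.over q ∧ q ∉ s.queries) ?_ hij hj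
    ⟨ha, hq⟩).2
  refine fun hs ⟨ha, hq⟩ => ⟨ha.mono hs.under_subset hs.over_subset, fun hq' => ?_⟩
  rcases hs.mem_queries_or_created hq' with hq' | ⟨q₀, rfl⟩
  · exact hq hq'
  · exact hs.not_answered_of_query ha

end IsTrace

open Classical in
/-- The number of applications of `Reach` at bounds less than `b`. Along a trace, the number for
the rule applications so far serves as the version number of the environment `U_ρ^{b-1}`. -/
noncomputable def reachesBelow (rs : List A.RuleApp) (b : ℕ) : ℕ :=
  rs.countP fun r => decide (∃ q, r = .reach q ∧ q.bound < b)

theorem reachesBelow_take_le (rs : List A.RuleApp) (i b : ℕ) :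
    reachesBelow (rs.take i) b ≤ reachesBelow rs b :=
  (List.take_sublist i rs).countP_le

theorem reachesBelow_take_mono (rs : List A.RuleApp) (b : ℕ) (hij : i ≤ j) :
    reachesBelow (rs.take i) b ≤ reachesBelow (rs.take j) b :=
  (List.take_sublist_take_left hij).countP_le

theorem le_bound_of_reachesBelow_take_succ_eq {b : ℕ} {q : A.Triple}
    (hq : rs[i]? = some (.reach q))
    (h : reachesBelow (rs.take (i + 1)) b = reachesBelow (rs.take i) b) : b ≤ q.bound := by
  by_contra! hlt
  simp [reachesBelow, List.take_add_one, hq, List.countP_append, hlt] at h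

theorem IsTrace.mem_under_iff_of_reachesBelow_eq (h : IsTrace T φ n f rs) {b : ℕ} (hij : i ≤ j)
    (hj : j ≤ rs.length) (hb : reachesBelow (rs.take i) b = reachesBelow (rs.take j) b)
    {t : A.Triple} (ht : t.bound < b) : t ∈ (f i).under ↔ t ∈ (f j).under := by
  refine ⟨fun hi => h.under_subset hij hj hi, ?_⟩
  induction j, hij using Nat.le_induction with
  | base => exact id
  | succ j hij ih =>
    have hle := reachesBelow_take_mono rs b hij
    have hle' := reachesBelow_take_mono rs b (Nat.le_add_right j 1)
    have hr := List.getElem?_eq_getElem hj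
    intro htj
    rcases (h.step hr).mem_under_or htj with htj | ⟨q, hq, htq⟩
    · exact ih (Nat.le_of_lt hj) (by omega) htj
    · have hbq := le_bound_of_reachesBelow_take_succ_eq (b := b) (hq ▸ hr) (by omega)
      omega

theorem IsTrace.interp_underEnvPred_eq (h : IsTrace T φ n f rs) {b : ℕ} (hij : i ≤ j)
    (hj : j ≤ rs.length) (hb : reachesBelow (rs.take i) b = reachesBelow (rs.take j) b)
    {M : Type*} [L.Structure M] :
    (underEnvPred (f i).under b).interp M = (underEnvPred (f j).under b).interp M :=
  interp_underEnvPred_congr fun _ ht => h.mem_under_iff_of_reachesBelow_eq hij hj hb ht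

end Traces

/-! ### Applications of `Reach` -/

section ReachCount

variable {T : L.Theory} {φ : L.Formula (A.Formals A.main)} {n : ℕ} {f : ℕ → A.State}
  {rs : List A.RuleApp} {i j : ℕ} {P : A.Proc} {b : ℕ}
  {π : List (Literal L A.toProcSig (A.Vars P))}

/-- The `i`-th rule application is an application of `Reach` at bound `b` along the path `π`. -/
def ReachesAlong (T : L.Theory) (f : ℕ → A.State) (rs : List A.RuleApp) (i : ℕ) {P : A.Proc}
    (b : ℕ) (π : List (Literal L A.toProcSig (A.Vars P))) : Prop :=
  ∃ χ : L.Formula (A.Formals P), rs[i]? = some (.reach ⟨P, χ, b⟩) ∧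
    ¬ T ⊨ᵇ (reachFact (f i).under P b π).imp (∼χ) ∧
    (⟨P, reachFact (f i).under P b π, b⟩ : A.Triple) ∈ (f (i + 1)).under

-- The fact inferred first still excludes every query that meets the fact inferred later.
theorem IsTrace.not_reachesAlong_of_lt (h : IsTrace T φ n f rs) (hij : i < j)
    (hj : j < rs.length) (hi : ReachesAlong T f rs i b π)
    (hπ : ∀ (I : Theory.ModelType.{u, v, max u v} T) (x : A.Vars P → I),
      ConjRealize ((underEnvPred (f j).under b).interp I) x π →
        ConjRealize ((underEnvPred (f i).under b).interp I) x π) :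
    ¬ ReachesAlong T f rs j b π := by
  rintro ⟨χ, hr, hmeets, -⟩
  obtain ⟨_, -, -, hfact⟩ := hi
  obtain ⟨I, x, hx, hχ⟩ := not_models_imp_not_iff.1 hmeets
  obtain ⟨y, hy⟩ := realize_reachFact.1 hx
  refine h.unreached hj.le ⟨P, χ, b⟩ ((h.step hr).mem_queries_of_on rfl) I x ?_ hχ
  exact mem_underEnv.2 ⟨_, b, le_rfl, h.under_subset hij hj.le hfact,
    realize_reachFact.2 ⟨y, hπ I _ hy⟩⟩

theorem ReachesAlong.exists_mem_under (h : ReachesAlong T f rs i b π) (hπ : π ∈ A.paths P)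
    (hcall : ∃ l ∈ π, l.1.IsCall) : ∃ t ∈ (f i).under, t.bound < b := by
  obtain ⟨χ, -, hmeets, -⟩ := h
  obtain ⟨I, x, hx, -⟩ := not_models_imp_not_iff.1 hmeets
  obtain ⟨y, hy⟩ := realize_reachFact.1 hx
  obtain ⟨l, hl, hc⟩ := hcall
  have hpos : l.2 = true := call_pos_of_mem_paths hπ l hl hc
  obtain ⟨⟨_, _⟩ | ⟨_, _⟩ | ⟨R, a⟩, sign⟩ := l
  · exact hc.elim
  · exact hc.elim
  · obtain rfl : sign = true := hpos
    obtain ⟨δ, b', hb', hδ, -⟩ := mem_underEnvPred.1 (hy _ hl)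
    exact ⟨_, hδ, hb'⟩

open Classical in
/-- The indices of the rule applications that are applications of `Reach` at bound `b` along the
path `π`. -/
noncomputable def reachIndices (T : L.Theory) (f : ℕ → A.State) (rs : List A.RuleApp)
    {P : A.Proc} (b : ℕ) (π : List (Literal L A.toProcSig (A.Vars P))) : Finset ℕ :=
  (Finset.range rs.length).filter fun i => ReachesAlong T f rs i b π

theorem ReachesAlong.lt_length (h : ReachesAlong T f rs i b π) : i < rs.length :=
  let ⟨_, hr, _⟩ := h
  (List.getElem?_eq_some_iff.1 hr).1

theorem mem_reachIndices : i ∈ reachIndices T f rs b π ↔ ReachesAlong T f rs i b π := by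
  classical
  exact Finset.mem_filter.trans
    (and_iff_right_of_imp fun h => Finset.mem_range.2 h.lt_length)

theorem lt_length_of_mem_reachIndices (hi : i ∈ reachIndices T f rs b π) : i < rs.length :=
  (mem_reachIndices.1 hi).lt_length

theorem IsTrace.numReach_le_sum (h : IsTrace T φ n f rs) (P : A.Proc) (b : ℕ) :
    numReach rs P b ≤
      ∑ π ∈ A.paths P, ∑ i ∈ Finset.range (b + 1), (reachIndices T f rs i π).card := by
  classical
  rw [← Finset.sum_product', numReach, countP_eq_card_filter_range]
  refine (Finset.card_le_card fun j hj => ?_).trans Finset.card_biUnion_le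
  obtain ⟨r, hr, hp⟩ := (Option.any_eq_true ..).1 (Finset.mem_filter.1 hj).2
  obtain ⟨⟨P, χ, i⟩, rfl, rfl, hi⟩ := of_decide_eq_true hp
  obtain ⟨π, hπ, hreach⟩ := (h.step hr).exists_path
  exact Finset.mem_biUnion.2 ⟨(π, i), Finset.mem_product.2
    ⟨hπ, Finset.mem_range.2 (Nat.lt_succ_of_le hi)⟩, mem_reachIndices.2 ⟨χ, hr, hreach⟩⟩

theorem IsTrace.reachesBelow_take_ne_of_lt (h : IsTrace T φ n f rs) (hij : i < j)
    (hi : i ∈ reachIndices T f rs b π) (hj : j ∈ reachIndices T f rs b π) :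
    reachesBelow (rs.take i) b ≠ reachesBelow (rs.take j) b := by
  have hlt := lt_length_of_mem_reachIndices hj
  refine fun hv => h.not_reachesAlong_of_lt hij hlt (mem_reachIndices.1 hi) (fun I x hx => ?_)
    (mem_reachIndices.1 hj)
  rwa [h.interp_underEnvPred_eq hij.le hlt.le hv]

theorem IsTrace.card_reachIndices_le_card (h : IsTrace T φ n f rs) {V : Finset ℕ}
    (hV : ∀ i ∈ reachIndices T f rs b π, reachesBelow (rs.take i) b ∈ V) :
    (reachIndices T f rs b π).card ≤ V.card := by
  refine Finset.card_le_card_of_injOn (fun i => reachesBelow (rs.take i) b) hV ?_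
  intro i hi j hj hv
  rcases lt_trichotomy i j with hij | hij | hij
  · exact absurd hv (h.reachesBelow_take_ne_of_lt hij hi hj)
  · exact hij
  · exact absurd hv.symm (h.reachesBelow_take_ne_of_lt hij hj hi)

theorem IsTrace.card_reachIndices_le (h : IsTrace T φ n f rs) (b : ℕ)
    (π : List (Literal L A.toProcSig (A.Vars P))) :
    (reachIndices T f rs b π).card ≤ reachesBelow rs b + 1 := by
  refine (h.card_reachIndices_le_card (V := Finset.range (reachesBelow rs b + 1))
    fun i _ => ?_).trans_eq (Finset.card_range _)
  exact Finset.mem_range.2 (Nat.lt_succ_of_le (reachesBelow_take_le rs i b))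

theorem IsTrace.card_reachIndices_le_one (h : IsTrace T φ n f rs) (b : ℕ)
    (hπ : ∀ l ∈ π, ¬ l.1.IsCall) : (reachIndices T f rs b π).card ≤ 1 := by
  have hnot {i j : ℕ} (hij : i < j) (hi : i ∈ reachIndices T f rs b π) :
      j ∉ reachIndices T f rs b π := fun hj =>
    h.not_reachesAlong_of_lt hij (lt_length_of_mem_reachIndices hj) (mem_reachIndices.1 hi)
      (fun I x => (conjRealize_congr_of_not_isCall hπ _ _ x).1) (mem_reachIndices.1 hj)
  refine Finset.card_le_one.2 fun i hi j hj => ?_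
  rcases lt_trichotomy i j with hij | hij | hij
  · exact absurd hj (hnot hij hi)
  · exact hij
  · exact absurd hi (hnot hij hj)

theorem IsTrace.card_reachIndices_le_of_under_eq_empty (h : IsTrace T φ n f rs)
    (hempty : (f 0).under = ∅) (hπ : π ∈ A.paths P) (hcall : ∃ l ∈ π, l.1.IsCall) :
    (reachIndices T f rs b π).card ≤ reachesBelow rs b := by
  refine (h.card_reachIndices_le_card (V := Finset.Ioc 0 (reachesBelow rs b))
    fun i hi => ?_).trans_eq (by simp)
  refine Finset.mem_Ioc.2 ⟨Nat.pos_of_ne_zero fun hv => ?_, reachesBelow_take_le rs i b⟩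
  obtain ⟨t, ht, hb⟩ := (mem_reachIndices.1 hi).exists_mem_under hπ hcall
  have ht₀ := (h.mem_under_iff_of_reachesBelow_eq (Nat.zero_le i)
    (lt_length_of_mem_reachIndices hi).le (hv.symm ▸ rfl) hb).2 ht
  simp [hempty] at ht₀

theorem IsTrace.numReach_le_mul (h : IsTrace T φ n f rs) {d : ℕ} (hd : ∀ π ∈ A.paths P,
    ∑ i ∈ Finset.range (b + 1), (reachIndices T f rs i π).card ≤ d) :
    numReach rs P b ≤ A.maxPaths * d :=
  calc numReach rs P b
    _ ≤ ∑ π ∈ A.paths P, ∑ i ∈ Finset.range (b + 1), (reachIndices T f rs i π).card :=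
        h.numReach_le_sum P b
    _ ≤ (A.paths P).card * d := Finset.sum_le_card_nsmul _ _ _ hd
    _ ≤ A.maxPaths * d := Nat.mul_le_mul_right d (card_paths_le P)

@[simp]
theorem reachesBelow_zero (rs : List A.RuleApp) : reachesBelow rs 0 = 0 := by
  simp [reachesBelow]

theorem reachesBelow_succ_le {d : ℕ} (hd : ∀ P, numReach rs P b ≤ A.maxPaths * d) :
    reachesBelow rs (b + 1) ≤ A.numProcs * A.maxPaths * d := by
  classical
  calc reachesBelow rs (b + 1)
    _ ≤ ∑ P, numReach rs P b := by
        refine countP_le_sum_countP rs _ _ _ fun r _ hr => ?_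
        obtain ⟨q, hq, hb⟩ := of_decide_eq_true hr
        exact ⟨q.proc, Finset.mem_univ _, decide_eq_true ⟨q, hq, rfl, Nat.le_of_lt_succ hb⟩⟩
    _ ≤ A.numProcs * A.maxPaths * d :=
        (Finset.sum_le_card_nsmul _ _ _ fun P _ => hd P).trans_eq (by simp [mul_assoc])

theorem IsTrace.reachesBelow_lt_pow (h : IsTrace T φ n f rs) (b : ℕ) :
    reachesBelow rs b < (A.numProcs * A.maxPaths + 1) ^ b := by
  induction b using Nat.strong_induction_on with
  | _ b ih =>
  cases b with
  | zero => simp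
  | succ b =>
    rw [← geom_sum_mul_add, Nat.lt_add_one_iff, mul_comm]
    refine reachesBelow_succ_le fun P => h.numReach_le_mul fun π _ =>
      Finset.sum_le_sum fun i hi => ?_
    exact (h.card_reachIndices_le i π).trans (ih i (Finset.mem_range.1 hi))

theorem numProcs_mul_maxPaths_pos (hπ : π ∈ A.paths P) : 0 < A.numProcs * A.maxPaths :=
  Nat.mul_pos P.pos ((Finset.card_pos.2 ⟨π, hπ⟩).trans_le (card_paths_le P))

-- A path without calls is used at most once at each of the `b + 1` bounds. A path with calls is
-- not used at bound `0`, and at bound `i + 1` at most `Np (Np + 1) ^ i` times, by induction.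
theorem IsTrace.numReach_le (h : IsTrace T φ n f rs) (hempty : (f 0).under = ∅) (P : A.Proc)
    (b : ℕ) : numReach rs P b ≤ A.maxPaths * (A.numProcs * A.maxPaths + 1) ^ b := by
  induction b using Nat.strong_induction_on generalizing P with
  | _ b ih =>
  refine h.numReach_le_mul fun π hπ => ?_
  by_cases hcall : ∃ l ∈ π, l.1.IsCall
  · have hcard (i : ℕ) := h.card_reachIndices_le_of_under_eq_empty (b := i) hempty hπ hcall
    rw [Finset.sum_range_succ', ← geom_sum_mul_add, Finset.sum_mul]
    refine Nat.add_le_add (Finset.sum_le_sum fun i hi => ?_) ((hcard 0).trans (by simp))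
    rw [mul_comm]
    exact (hcard (i + 1)).trans (reachesBelow_succ_le fun P => ih i (Finset.mem_range.1 hi) P)
  · push Not at hcall
    calc ∑ i ∈ Finset.range (b + 1), (reachIndices T f rs i π).card
      _ ≤ b + 1 := by
          simpa using Finset.sum_le_card_nsmul (Finset.range (b + 1)) _ 1
            fun i _ => h.card_reachIndices_le_one i hcall
      _ ≤ 2 ^ b := Nat.lt_two_pow_self
      _ ≤ (A.numProcs * A.maxPaths + 1) ^ b :=
          Nat.pow_le_pow_left (Nat.succ_le_succ (numProcs_mul_maxPaths_pos hπ)) b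

theorem exists_isCall_of_maxCalls_ne_zero (h : A.maxCalls ≠ 0) :
    ∃ P, ∃ π ∈ A.paths P, ∃ l ∈ π, l.1.IsCall := by
  classical
  by_contra! hcon
  refine h ((Finset.sup_eq_bot_iff _ _).2 fun P _ => (Finset.sup_eq_bot_iff _ _).2 fun π hπ => ?_)
  exact List.countP_eq_zero.2 fun l hl hc => hcon P π hπ l hl (of_decide_eq_true hc)

theorem exists_isCall_of_mem_paths (hNp : A.numProcs * A.maxPaths = 1) (hc : A.maxCalls ≠ 0)
    (hπ : π ∈ A.paths P) : ∃ l ∈ π, l.1.IsCall := by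
  obtain ⟨P₀, π₀, hπ₀, hl⟩ := exists_isCall_of_maxCalls_ne_zero hc
  have hN := Nat.eq_one_of_mul_eq_one_right hNp
  have hp := Nat.eq_one_of_mul_eq_one_left hNp
  obtain rfl : P = P₀ := Fin.ext (by omega)
  rwa [Finset.card_le_one.1 ((card_paths_le P).trans hp.le) π hπ π₀ hπ₀]

theorem IsTrace.reachesBelow_eq_zero (h : IsTrace T φ n f rs) (hempty : (f 0).under = ∅)
    (hcall : ∀ P, ∀ π ∈ A.paths P, ∃ l ∈ π, l.1.IsCall) (b : ℕ) : reachesBelow rs b = 0 := by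
  induction b using Nat.strong_induction_on with
  | _ b ih =>
  cases b with
  | zero => simp
  | succ b =>
    refine Nat.le_zero.1 (reachesBelow_succ_le (d := 0) fun P => h.numReach_le_mul fun π hπ =>
      (Finset.sum_eq_zero fun i hi => ?_).le)
    rw [← Nat.le_zero, ← ih i (Finset.mem_range.1 hi)]
    exact h.card_reachIndices_le_of_under_eq_empty hempty hπ (hcall P π hπ)

end ReachCount

/-! ### Applications of `Query`, `Sum`, and `Reach` to a given query -/

section QueryCount

variable {T : L.Theory} {φ : L.Formula (A.Formals A.main)} {n : ℕ} {f : ℕ → A.State}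
  {rs : List A.RuleApp} {i j : ℕ} {q : A.Triple}

-- The query created first contains the one created later. While it is open, it overlaps the later
-- one; it has not been reached since the reachability facts are the same; and once it is blocked,
-- so is the later one.
theorem IsTrace.getElem?_ne_query_of_lt (h : IsTrace T φ n f rs) (hij : i < j)
    (hj : j < rs.length) {c : A.CallSite q.proc} (hc : c.path ∈ A.paths q.proc) {b : ℕ}
    (hv : reachesBelow (rs.take i) (b + 1) = reachesBelow (rs.take j) (b + 1))
    (hi : rs[i]? = some (.query q (c.subquery (f i).under (f i).over q.fml b))) :
    rs[j]? ≠ some (.query q (c.subquery (f j).under (f j).over q.fml b)) := by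
  intro hrj
  obtain ⟨hblocked, -⟩ := not_or.1 (h.step hrj).not_answered_of_query
  have hunder (M : Type (max u v)) [L.Structure M] :
      (underEnv (f i).under b).interp M = (underEnv (f j).under b).interp M :=
    h.interp_underEnvPred_eq (b := b + 1) hij.le hj.le hv
  have himp (I : Theory.ModelType.{u, v, max u v} T) (z : A.Formals c.callee → I)
      (hz : (c.subquery (f j).under (f j).over q.fml b).fml.Realize z) :
      (c.subquery (f i).under (f i).over q.fml b).fml.Realize z :=
    CallSite.realize_subquery_mono hc (hunder I).ge
      (interp_overEnv_anti (h.over_subset hij.le hj.le) le_rfl) hz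
  rcases h.mem_queries_or_answered hij hj.le (h.step hi).mem_queries_of_query with
    hopen | hblocked' | hreached
  · refine hblocked fun I x _ hx => ?_
    exact models_imp_not_iff.1 ((h.step hrj).models_imp_not_of_query hopen) I x hx (himp I x hx)
  · exact hblocked fun I x hx hx' => hblocked' I x hx (himp I x hx')
  · refine (h.step hi).not_answered_of_query (.inr fun hu => hreached fun I x hx => hu I x ?_)
    exact (hunder I).symm ▸ hx

theorem IsTrace.numQuery_le_mul (h : IsTrace T φ n f rs) (q : A.Triple) :
    numQuery rs q ≤ A.maxPaths * A.maxCalls * (reachesBelow rs q.bound + 1) := by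
  classical
  calc numQuery rs q
    _ ≤ (callPositions q.proc ×ˢ Finset.range (reachesBelow rs q.bound + 1)).card := by
        refine countP_le_card_of_forall_subsingleton (fun i k => ∃ (c : A.CallSite q.proc) (b : ℕ),
          c.path ∈ A.paths q.proc ∧ q.bound = b + 1 ∧
          rs[i]? = some (.query q (c.subquery (f i).under (f i).over q.fml b)) ∧
          k = (⟨c.path, c.pre.length⟩, reachesBelow (rs.take i) q.bound)) ?_ ?_
        · intro i r hr hp
          obtain ⟨q', rfl⟩ := of_decide_eq_true hp
          obtain ⟨c, b, hc, hb, rfl⟩ := (h.step hr).exists_callSite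
          exact ⟨_, Finset.mem_product.2 ⟨CallSite.mem_callPositions hc,
            Finset.mem_range.2 (Nat.lt_succ_of_le (reachesBelow_take_le rs i _))⟩,
            c, b, hc, hb, hr, rfl⟩
        · rintro i j k hij hj ⟨c, b, hc, hb, hi, rfl⟩ ⟨c', b', -, hb', hrj, hk⟩
          obtain rfl : b = b' := by omega
          simp only [Prod.mk.injEq, Sigma.mk.injEq, heq_eq_eq] at hk
          obtain rfl := CallSite.eq_of_path_eq_of_length_eq hk.1.1 hk.1.2
          exact h.getElem?_ne_query_of_lt hij hj hc (hb ▸ hk.2) hi hrj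
    _ ≤ A.maxPaths * A.maxCalls * (reachesBelow rs q.bound + 1) := by
        rw [Finset.card_product, Finset.card_range]
        exact Nat.mul_le_mul_right _ (card_callPositions_le _)

theorem IsTrace.numQuery_le (h : IsTrace T φ n f rs) (q : A.Triple) :
    numQuery rs q ≤ A.maxCalls * A.maxPaths * (A.numProcs * A.maxPaths + 1) ^ q.bound := by
  rw [mul_comm A.maxCalls]
  exact (h.numQuery_le_mul q).trans (Nat.mul_le_mul_left _ (h.reachesBelow_lt_pow _))

theorem IsTrace.numQuery_eq_zero (h : IsTrace T φ n f rs) (hq : q.bound = 0) :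
    numQuery rs q = 0 := by
  classical
  refine List.countP_eq_zero.2 fun r hr hp => ?_
  obtain ⟨q', rfl⟩ := of_decide_eq_true hp
  obtain ⟨i, hi⟩ := List.mem_iff_getElem?.1 hr
  obtain ⟨-, b, -, hb, -⟩ := (h.step hi).exists_callSite
  omega

theorem IsTrace.bound_of_query_mem (h : IsTrace T φ n f rs) {q' : A.Triple}
    (hq' : .query q q' ∈ rs) : q.bound = q'.bound + 1 := by
  obtain ⟨i, hi⟩ := List.mem_iff_getElem?.1 hq'
  obtain ⟨c, b, -, hb, rfl⟩ := (h.step hi).exists_callSite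
  exact hb

open Classical in
/-- The number of applications of `Sum` and `Reach` to the query `q`. -/
noncomputable def numAnswer (rs : List A.RuleApp) (q : A.Triple) : ℕ :=
  rs.countP fun r => decide (r = .sum q ∨ r = .reach q)

theorem IsTrace.numAnswer_le_one (h : IsTrace T φ n f rs) (q : A.Triple) :
    numAnswer rs q ≤ 1 := by
  classical
  refine countP_le_card_of_forall_subsingleton (K := {()})
    (fun i _ => rs[i]? = some (.sum q) ∨ rs[i]? = some (.reach q)) (fun i r hr hp => ?_) ?_
  · refine ⟨(), Finset.mem_singleton_self _, ?_⟩
    rcases of_decide_eq_true hp with rfl | rfl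
    · exact .inl hr
    · exact .inr hr
  · intro i j _ hij hj hi hj'
    have hclosed : q ∈ (f i).queries ∧ q ∉ (f (i + 1)).queries := by
      rcases hi with hi | hi
      · exact ⟨(h.step hi).mem_queries_of_on rfl, (h.step hi).notMem_queries_of_sum⟩
      · exact ⟨(h.step hi).mem_queries_of_on rfl, (h.step hi).notMem_queries_of_reach⟩
    have hanswered : Answered T (f (i + 1)).under (f (i + 1)).over q :=
      (h.mem_queries_or_answered i.le_succ (by omega) hclosed.1).resolve_left hclosed.2
    refine h.notMem_queries_of_answered hij hj.le hanswered hclosed.2 ?_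
    rcases hj' with hj' | hj' <;> exact (h.step hj').mem_queries_of_on rfl

end QueryCount

/-! ### The work spent on a query -/

section Work

variable {T : L.Theory} {φ : L.Formula (A.Formals A.main)} {n : ℕ} {f : ℕ → A.State}
  {rs : List A.RuleApp} {q : A.Triple}

open Classical in
/-- The queries created by applying `Query` to the query `q`. -/
noncomputable def children (rs : List A.RuleApp) (q : A.Triple) : Finset A.Triple :=
  (rs.filterMap fun
    | .query q₀ q' => if q₀ = q then some q' else none
    | _ => none).toFinset

theorem mem_children {q' : A.Triple} : q' ∈ children rs q ↔ .query q q' ∈ rs := by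
  simp only [children, List.mem_toFinset, List.mem_filterMap]
  constructor
  · rintro ⟨_ | _ | ⟨q₀, q''⟩ | _ | _, hr, h⟩ <;> simp_all
  · exact fun h => ⟨_, h, by simp⟩

theorem card_children_le : (children rs q).card ≤ numQuery rs q := by
  classical
  refine (List.toFinset_card_le _).trans (List.length_filterMap_eq_countP.trans_le ?_)
  refine List.countP_mono_left fun r _ hr => decide_eq_true ?_
  rcases r with _ | _ | ⟨q₀, q'⟩ | _ | _ <;> simp_all

open Classical in
theorem countP_on_le : (rs.countP fun r => decide (r.On q)) ≤ numAnswer rs q + numQuery rs q :=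
  countP_le_add_countP rs _ _ _ fun r _ hr => by
    have hr := of_decide_eq_true hr
    cases r <;> simp_all [RuleApp.On]

theorem work_le_add_sum (rs : List A.RuleApp) (q : A.Triple) :
    work rs q ≤ numAnswer rs q + numQuery rs q + ∑ q' ∈ children rs q, work rs q' := by
  classical
  refine (countP_le_add_countP rs _ (fun r => decide (r.On q))
    (fun r => decide (∃ q₁ ∈ children rs q, ∃ q', Descends rs q₁ q' ∧ r.On q')) ?_).trans
    (Nat.add_le_add countP_on_le (countP_le_sum_countP rs _ _ _ ?_))
  · intro r _ hr
    obtain ⟨q', hd, hon⟩ := of_decide_eq_true hr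
    rcases Relation.ReflTransGen.cases_head hd with rfl | ⟨q₁, hq₁, hd⟩
    · exact .inl (decide_eq_true hon)
    · exact .inr (decide_eq_true ⟨q₁, mem_children.2 hq₁, q', hd, hon⟩)
  · intro r _ hr
    obtain ⟨q₁, hq₁, hr⟩ := of_decide_eq_true hr
    exact ⟨q₁, hq₁, decide_eq_true hr⟩

/-- A bound on the work spent on a query at bound `b`, when `Query` is applied at most `g b` times
to each such query. -/
def workBound (g : ℕ → ℕ) : ℕ → ℕ
  | 0 => 1
  | b + 1 => 1 + g (b + 1) * (1 + workBound g b)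

theorem IsTrace.work_le_workBound (h : IsTrace T φ n f rs) {g : ℕ → ℕ}
    (hg : ∀ q, numQuery rs q ≤ g q.bound) {b : ℕ} (hb : q.bound = b) :
    work rs q ≤ workBound g b := by
  induction b generalizing q with
  | zero =>
    have hquery := h.numQuery_eq_zero hb
    have hchildren : children rs q = ∅ :=
      Finset.card_eq_zero.1 (Nat.le_zero.1 (card_children_le.trans_eq hquery))
    simpa [hquery, hchildren, workBound] using
      (work_le_add_sum rs q).trans (Nat.add_le_add_right (Nat.add_le_add_right
        (h.numAnswer_le_one q) _) _)
  | succ b ih =>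
    have hchild (q') (hq' : q' ∈ children rs q) : work rs q' ≤ workBound g b :=
      ih (by have := h.bound_of_query_mem (mem_children.1 hq'); omega)
    calc work rs q
      _ ≤ numAnswer rs q + numQuery rs q + ∑ q' ∈ children rs q, work rs q' :=
          work_le_add_sum rs q
      _ ≤ 1 + numQuery rs q + numQuery rs q * workBound g b := by
          refine Nat.add_le_add (Nat.add_le_add_right (h.numAnswer_le_one q) _) ?_
          exact (Finset.sum_le_card_nsmul _ _ _ hchild).trans
            (Nat.mul_le_mul_right _ card_children_le)
      _ = 1 + numQuery rs q * (1 + workBound g b) := by ring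
      _ ≤ workBound g (b + 1) :=
          Nat.add_le_add_left (Nat.mul_le_mul_right _ (hb ▸ hg q)) 1

theorem workBound_le {c k : ℕ} (hc : 1 ≤ c) (hk : 1 ≤ k) (b : ℕ) :
    workBound (fun b => c * k ^ (2 * b + 1)) b ≤ (2 * b + 1) * (c ^ b * k ^ (b ^ 2 + 2 * b)) := by
  induction b with
  | zero => simp [workBound]
  | succ b ih =>
    set y := c * k ^ (2 * (b + 1) + 1) with hy
    set z := c ^ b * k ^ (b ^ 2 + 2 * b) with hz
    have hyz : c ^ (b + 1) * k ^ ((b + 1) ^ 2 + 2 * (b + 1)) = y * z := by rw [hy, hz]; ring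
    have hz_pos : 0 < z := Nat.mul_pos (pow_pos hc _) (pow_pos hk _)
    have hy_pos : 0 < y := Nat.mul_pos hc (pow_pos hk _)
    calc workBound (fun b => c * k ^ (2 * b + 1)) (b + 1)
      _ = 1 + y * (1 + workBound (fun b => c * k ^ (2 * b + 1)) b) := rfl
      _ ≤ 1 + y * (1 + (2 * b + 1) * z) := by gcongr
      _ = 1 + y * 1 + (2 * b + 1) * (y * z) := by ring
      _ ≤ y * z + y * z + (2 * b + 1) * (y * z) := by
          gcongr
          · exact Nat.mul_pos hy_pos hz_pos
          · exact hz_pos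
      _ = (2 * (b + 1) + 1) * (c ^ (b + 1) * k ^ ((b + 1) ^ 2 + 2 * (b + 1))) := by
          rw [hyz]; ring

-- When `Np = 1`, a call on the only path prevents any reachability fact; otherwise `Np + 1` is at
-- most `(Np) ^ 2`.
theorem IsTrace.numQuery_le_pow (h : IsTrace T φ n f rs) (hempty : (f 0).under = ∅)
    (q : A.Triple) :
    numQuery rs q ≤ max A.maxCalls 1 * max (A.numProcs * A.maxPaths) 1 ^ (2 * q.bound + 1) := by
  have hquery := h.numQuery_le_mul q
  rw [mul_comm A.maxPaths, mul_assoc] at hquery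
  by_cases hc : A.maxCalls = 0
  · exact hquery.trans (by simp [hc])
  refine hquery.trans (Nat.mul_le_mul (le_max_left _ _) ?_)
  have hp : A.maxPaths ≤ A.numProcs * A.maxPaths := Nat.le_mul_of_pos_left _ A.main.pos
  rcases Nat.lt_trichotomy (A.numProcs * A.maxPaths) 1 with hNp | hNp | hNp
  · simp [show A.maxPaths = 0 by omega]
  · rw [h.reachesBelow_eq_zero hempty (fun P π => exists_isCall_of_mem_paths hNp hc), hNp]
    simpa using hp.trans hNp.le
  · rw [max_eq_left hNp.le, pow_succ', pow_mul]
    refine Nat.mul_le_mul hp ((h.reachesBelow_lt_pow q.bound).trans_le ?_)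
    exact Nat.pow_le_pow_left (by nlinarith) q.bound

theorem IsTrace.work_le (h : IsTrace T φ n f rs) (hempty : (f 0).under = ∅) (q : A.Triple) :
    work rs q ≤ 3 * max q.bound 1 * max A.maxCalls 1 ^ q.bound *
      max (A.numProcs * A.maxPaths) 1 ^ (4 * q.bound ^ 2) := by
  have hNp : 1 ≤ max (A.numProcs * A.maxPaths) 1 := le_max_right _ _
  rw [mul_assoc (3 * _)]
  refine (h.work_le_workBound (h.numQuery_le_pow hempty) rfl).trans
    ((workBound_le (le_max_right _ _) hNp _).trans ?_)
  refine Nat.mul_le_mul (by omega) (Nat.mul_le_mul_left _ (Nat.pow_le_pow_right hNp ?_))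
  nlinarith [Nat.le_self_pow two_ne_zero q.bound]

theorem IsTrace.descends_of_mem_queries (h : IsTrace T φ n f rs) {q₀ : A.Triple}
    (hq₀ : (f 0).queries = {q₀}) {i : ℕ} (hi : i ≤ rs.length) (hq : q ∈ (f i).queries) :
    Descends rs q₀ q := by
  induction i generalizing q with
  | zero => exact (hq₀ ▸ hq : q ∈ ({q₀} : Set A.Triple)) ▸ .refl
  | succ i ih =>
    have hr := List.getElem?_eq_getElem hi
    rcases (h.step hr).mem_queries_or_created hq with hq | ⟨q₁, hq₁⟩
    · exact ih (Nat.le_of_lt hi) hq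
    · refine (ih (Nat.le_of_lt hi) ((h.step hr).mem_queries_of_on (q := q₁) ?_)).tail ?_
      · rw [hq₁]; rfl
      · exact hq₁ ▸ List.getElem_mem hi

theorem Step.not_isFinal {s s' : A.State} {r : A.RuleApp} (h : Step T φ n s r s') :
    ¬ s.IsFinal := by
  cases h <;> exact id

theorem Step.exists_on_or_isFinal {s s' : A.State} {r : A.RuleApp} (h : Step T φ n s r s') :
    (∃ q, r.On q) ∨ s'.IsFinal := by
  cases h with
  | resUnsafe => exact .inr trivial
  | resSafe => exact .inr trivial
  | _ => exact .inl ⟨_, rfl⟩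

-- All rules are applied to descendants of the initial query, except for the one that returns the
-- result.
theorem IsTrace.length_le (h : IsTrace T φ n f rs) {q₀ : A.Triple}
    (hq₀ : (f 0).queries = {q₀}) : rs.length ≤ work rs q₀ + 1 := by
  classical
  rw [List.length_eq_countP_add_countP fun r => decide (∃ q, Descends rs q₀ q ∧ r.On q)]
  refine Nat.add_le_add_left (countP_le_card_of_forall_subsingleton (K := {()})
    (fun i _ => (f (i + 1)).IsFinal) (fun i r hr hp => ⟨(), Finset.mem_singleton_self _, ?_⟩) ?_) _
  · refine (h.step hr).exists_on_or_isFinal.resolve_left fun ⟨q, hq⟩ => ?_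
    have hi := (List.getElem?_eq_some_iff.1 hr).1
    have hd := h.descends_of_mem_queries hq₀ hi.le ((h.step hr).mem_queries_of_on hq)
    simp only [decide_eq_true_eq] at hp
    exact hp ⟨q, hd, hq⟩
  · intro i j _ hij hj hfinal _
    refine (h.step (List.getElem?_eq_getElem hj)).not_isFinal ?_
    exact h.preserves (C := State.IsFinal) (fun hs hf => absurd hf hs.not_isFinal) hij hj.le hfinal

end Work

/-! ### Least fixed point semantics -/

section Semantics

variable (A) (M : Type*) [L.Structure M]

theorem bodySet_mono : Monotone (A.bodySet M) :=
  fun _ _ h P _ ⟨y, hy⟩ => ⟨y, QF.realize_mono (A.body_positive P) _ h hy⟩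

theorem bodySet_iSup {ι : Type*} [Nonempty ι] {X : ι → Interp A.toProcSig M}
    (hX : Directed (· ≤ ·) X) : A.bodySet M (⨆ i, X i) = ⨆ i, A.bodySet M (X i) := by
  ext P x
  simp only [bodySet, Set.mem_ofPred_eq, QF.realize_iSup_iff hX (A.body_positive P), iSup_apply,
    Set.iSup_eq_iUnion, Set.mem_iUnion]
  exact exists_comm

theorem sem_eq_lfp : A.sem M = OrderHom.lfp ⟨A.bodySet M, bodySet_mono A M⟩ :=
  congrArg sInf (Set.ext fun _ => forall₂_congr fun _ _ => exists_imp.symm)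

theorem sem_le {X : Interp A.toProcSig M} (h : A.bodySet M X ≤ X) : A.sem M ≤ X :=
  (sem_eq_lfp A M).trans_le (OrderHom.lfp_le _ h)

theorem bodySet_sem : A.bodySet M (A.sem M) = A.sem M := by
  rw [sem_eq_lfp]
  exact OrderHom.map_lfp ⟨A.bodySet M, bodySet_mono A M⟩

theorem boundedSem_eq_iterate (b : ℕ) : A.boundedSem M b = (A.bodySet M)^[b + 1] ⊥ := by
  induction b with
  | zero => rfl
  | succ b ih => rw [Function.iterate_succ_apply', ← ih]; rfl

theorem boundedSem_mono : Monotone (A.boundedSem M) := fun b c h => by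
  simpa only [boundedSem_eq_iterate] using
    (bodySet_mono A M).monotone_iterate_of_le_map bot_le (Nat.succ_le_succ h)

theorem sem_eq_iSup_boundedSem : A.sem M = ⨆ b, A.boundedSem M b := by
  refine le_antisymm (sem_le A M ?_) (iSup_le fun b => ?_)
  · rw [bodySet_iSup A M (boundedSem_mono A M).directed_le]
    exact iSup_le fun b => le_iSup (A.boundedSem M) (b + 1)
  · induction b with
    | zero => exact (bodySet_mono A M bot_le).trans_eq (bodySet_sem A M)
    | succ b ih => exact (bodySet_mono A M ih).trans_eq (bodySet_sem A M)

variable {A M} in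
theorem mem_sem_iff {P : A.Proc} {x : A.Formals P → M} :
    x ∈ A.sem M P ↔ ∃ b, x ∈ A.boundedSem M b P := by
  simp only [sem_eq_iSup_boundedSem, iSup_apply, Set.iSup_eq_iUnion, Set.mem_iUnion]

end Semantics

/-! ### Soundness of the assertion maps -/

section Soundness

variable {T : L.Theory} {φ : L.Formula (A.Formals A.main)} {n : ℕ}

theorem realize_of_models_body (I : Theory.ModelType.{u, v, max u v} T) {P : A.Proc}
    {E : Env L A.toProcSig} {δ : L.Formula (A.Formals P)}
    (h : T ⊨ᵇ ((A.body P).inst E).imp (δ.relabel Sum.inl)) {x : A.Formals P → I}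
    (hx : x ∈ A.bodySet I (E.interp I) P) : δ.Realize x := by
  obtain ⟨y, hy⟩ := hx
  simpa using realize_relabel_inl.1
    (models_imp_iff.1 h I (Sum.elim x y) ((QF.realize_inst _ _ _).2 hy))

/-- The soundness of the assertion maps: the facts in `ρ` are reachable, the facts in `σ` are
summaries, and all of them have bounds at most `n`. -/
structure SoundMaps (T : L.Theory) (n : ℕ) (ρ σ : A.AMap) : Prop where
  reachable : ∀ t ∈ ρ, ∀ (I : Theory.ModelType.{u, v, max u v} T) (x : A.Formals t.proc → I),
    t.fml.Realize x → x ∈ A.boundedSem I t.bound t.proc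
  summary : ∀ t ∈ σ, ∀ (I : Theory.ModelType.{u, v, max u v} T) (x : A.Formals t.proc → I),
    x ∈ A.boundedSem I t.bound t.proc → t.fml.Realize x
  bound_reachable : ∀ t ∈ ρ, t.bound ≤ n
  bound_summary : ∀ t ∈ σ, t.bound ≤ n

namespace SoundMaps

variable {ρ σ : A.AMap}

theorem empty : SoundMaps T n (∅ : A.AMap) ∅ := by
  constructor <;> simp

open Classical in
theorem insert_under (h : SoundMaps T n ρ σ) {t : A.Triple} (hb : t.bound ≤ n)
    (ht : ∀ (I : Theory.ModelType.{u, v, max u v} T) (x : A.Formals t.proc → I),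
      t.fml.Realize x → x ∈ A.boundedSem I t.bound t.proc) :
    SoundMaps T n (insert t ρ) σ where
  reachable := Finset.forall_mem_insert _ _ _ |>.2 ⟨ht, h.reachable⟩
  summary := h.summary
  bound_reachable := Finset.forall_mem_insert _ _ _ |>.2 ⟨hb, h.bound_reachable⟩
  bound_summary := h.bound_summary

open Classical in
theorem insert_over (h : SoundMaps T n ρ σ) {t : A.Triple} (hb : t.bound ≤ n)
    (ht : ∀ (I : Theory.ModelType.{u, v, max u v} T) (x : A.Formals t.proc → I),
      x ∈ A.boundedSem I t.bound t.proc → t.fml.Realize x) :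
    SoundMaps T n ρ (insert t σ) where
  reachable := h.reachable
  summary := Finset.forall_mem_insert _ _ _ |>.2 ⟨ht, h.summary⟩
  bound_reachable := h.bound_reachable
  bound_summary := Finset.forall_mem_insert _ _ _ |>.2 ⟨hb, h.bound_summary⟩

theorem interp_underEnv_le (h : SoundMaps T n ρ σ) (I : Theory.ModelType.{u, v, max u v} T)
    (b : ℕ) : (underEnv ρ b).interp I ≤ A.boundedSem I b := by
  intro P x hx
  obtain ⟨δ, b', hb', hδ, hr⟩ := mem_underEnv.1 hx
  exact boundedSem_mono A I hb' P (h.reachable _ hδ I x hr)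

theorem le_interp_overEnv (h : SoundMaps T n ρ σ) (I : Theory.ModelType.{u, v, max u v} T)
    (b : ℕ) : A.boundedSem I b ≤ (overEnv σ b).interp I :=
  fun P x hx => mem_overEnv.2 fun _ _ hb' hδ =>
    h.summary _ hδ I x (boundedSem_mono A I hb' P hx)

theorem interp_underEnvPred_le (h : SoundMaps T n ρ σ) (I : Theory.ModelType.{u, v, max u v} T)
    (b : ℕ) : (underEnvPred ρ b).interp I ≤ (A.bodySet I)^[b] ⊥ := by
  cases b with
  | zero => exact fun _ _ hx => absurd hx id
  | succ b => exact (h.interp_underEnv_le I b).trans_eq (boundedSem_eq_iterate A I b)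

theorem le_interp_overEnvPred (h : SoundMaps T n ρ σ) (I : Theory.ModelType.{u, v, max u v} T)
    (b : ℕ) : (A.bodySet I)^[b] ⊥ ≤ (overEnvPred σ b).interp I := by
  cases b with
  | zero => exact bot_le
  | succ b => exact (boundedSem_eq_iterate A I b).symm.trans_le (h.le_interp_overEnv I b)

theorem mem_boundedSem_of_realize_reachFact (h : SoundMaps T n ρ σ) {P : A.Proc} {b : ℕ}
    {π : List (Literal L A.toProcSig (A.Vars P))} (hπ : π ∈ A.paths P)
    (I : Theory.ModelType.{u, v, max u v} T) {x : A.Formals P → I}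
    (hx : (reachFact ρ P b π).Realize x) : x ∈ A.boundedSem I b P := by
  obtain ⟨y, hy⟩ := realize_reachFact.1 hx
  rw [boundedSem_eq_iterate, Function.iterate_succ_apply']
  exact bodySet_mono A I (h.interp_underEnvPred_le I b) P ⟨y, body_realize_iff.2 ⟨π, hπ, hy⟩⟩

theorem realize_of_models_overEnvPred (h : SoundMaps T n ρ σ) {P : A.Proc} {b : ℕ}
    {δ : L.Formula (A.Formals P)}
    (hδ : T ⊨ᵇ ((A.body P).inst (overEnvPred σ b)).imp (δ.relabel Sum.inl))
    (I : Theory.ModelType.{u, v, max u v} T) {x : A.Formals P → I}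
    (hx : x ∈ A.boundedSem I b P) : δ.Realize x := by
  rw [boundedSem_eq_iterate, Function.iterate_succ_apply'] at hx
  exact realize_of_models_body I hδ (bodySet_mono A I (h.le_interp_overEnvPred I b) P hx)

theorem push (h : SoundMaps T n ρ σ) : SoundMaps T (n + 1) ρ (push T σ n) := by
  classical
  have hpush : ∀ t ∈ Program.push T σ n, t ∈ σ ∨ t.bound = n + 1 ∧
      T ⊨ᵇ ((A.body t.proc).inst (overEnv σ n)).imp (t.fml.relabel Sum.inl) := by
    intro t ht
    rcases Finset.mem_union.1 ht with ht | ht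
    · exact .inl ht
    · obtain ⟨t', ht', rfl⟩ := Finset.mem_image.1 ht
      exact .inr ⟨rfl, (Finset.mem_filter.1 ht').2.2⟩
  refine ⟨h.reachable, fun t ht I x hx => ?_, fun t ht => (h.bound_reachable t ht).trans n.le_succ,
    fun t ht => ?_⟩
  · rcases hpush t ht with ht | ⟨hb, hmodels⟩
    · exact h.summary t ht I x hx
    · exact h.realize_of_models_overEnvPred (b := n + 1) hmodels I (hb ▸ hx)
  · rcases hpush t ht with ht | ⟨hb, -⟩
    · exact (h.bound_summary t ht).trans n.le_succ
    · exact hb.le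

-- All facts in `ρ` are below `n`, so `ρ` still satisfies `φ` at the bound `n + 1`.
theorem unreached_succ (h : SoundMaps T n ρ σ) (hsafe : T ⊨ᵇ (overEnv σ n A.main).imp φ) :
    Unreached T ρ ⟨A.main, ∼φ, n + 1⟩ := by
  intro I x hx
  obtain ⟨δ, b, -, hδ, hr⟩ := mem_underEnv.1 hx
  have hx : x ∈ (underEnv ρ n).interp I A.main :=
    mem_underEnv.2 ⟨δ, b, h.bound_reachable _ hδ, hδ, hr⟩
  exact not_not.2 (models_imp_iff.1 hsafe I x
    (h.le_interp_overEnv I n _ (h.interp_underEnv_le I n _ hx)))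

-- The summary facts at the bound `n` define a prefixed point of the semantics.
theorem satisfies_of_isInductive (h : SoundMaps T n ρ σ)
    (hsafe : T ⊨ᵇ (overEnv σ n A.main).imp φ) (hind : IsInductive T σ n) : A.Satisfies T φ := by
  intro I x hx
  refine models_imp_iff.1 hsafe I x
    (sem_le A I (X := (overEnv σ n).interp I) (fun P y hy => mem_overEnv.2 ?_) A.main hx)
  intro δ b hb hδ
  obtain rfl : b = n := le_antisymm (h.bound_summary _ hδ) hb
  exact realize_of_models_body I (hind P δ hδ) hy

end SoundMaps

theorem Step.soundMaps {s s' : A.State} {r : A.RuleApp} (h : Step T φ n s r s')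
    (hs : SoundMaps T n s.under s.over) (hQ : ∀ q ∈ s.queries, q.bound ≤ n) :
    SoundMaps T n s'.under s'.over := by
  classical
  cases h with
  | sum Q ρ σ P χ b ψ mem _ itp_left =>
    exact hs.insert_over (t := ⟨P, ψ, b⟩) (hQ ⟨P, χ, b⟩ mem) fun I _ =>
      hs.realize_of_models_overEnvPred itp_left I
  | reach Q ρ σ P χ b π mem path =>
    exact hs.insert_under (t := ⟨P, reachFact ρ P b π, b⟩) (hQ ⟨P, χ, b⟩ mem) fun I _ =>
      hs.mem_boundedSem_of_realize_reachFact path I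
  | _ => exact hs

/-! ### Termination of `BndSafety` -/

theorem unreached_empty (q : A.Triple) : Unreached T ∅ q := fun I x hx => by
  obtain ⟨_, _, -, h, -⟩ := mem_underEnv.1 hx
  exact absurd h (Finset.notMem_empty _)

theorem Run.exists_isTrace_of_singleton {q : A.Triple} {ρ σ : A.AMap} {s : A.State}
    {rs : List A.RuleApp} (h : Run T φ n (.running {q} ρ σ) rs s) (hq : Unreached T ρ q) :
    ∃ f, f 0 = .running {q} ρ σ ∧ IsTrace T φ n f rs := by
  obtain ⟨f, hf₀, -, hf⟩ := h.exists_isTrace fun _ hq' => (Set.mem_singleton_iff.1 hq') ▸ hq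
  exact ⟨f, hf₀, hf⟩

theorem Run.length_le_workBound {q : A.Triple} {ρ σ : A.AMap} {s : A.State}
    {rs : List A.RuleApp} (h : Run T φ n (.running {q} ρ σ) rs s) (hq : Unreached T ρ q) :
    rs.length ≤ workBound (fun b => A.maxCalls * A.maxPaths *
      (A.numProcs * A.maxPaths + 1) ^ b) q.bound + 1 := by
  obtain ⟨f, hf₀, hf⟩ := h.exists_isTrace_of_singleton hq
  exact (hf.length_le (by rw [hf₀]; rfl)).trans
    (Nat.add_le_add_right (hf.work_le_workBound hf.numQuery_le rfl) 1)

theorem acc_bndStep {q : A.Triple} {ρ σ : A.AMap} (hq : Unreached T ρ q) :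
    Acc (fun s' s => BndStep T φ n s s') (.running {q} ρ σ) := by
  by_contra hacc
  obtain ⟨f, hf₀, hf⟩ := not_acc_iff_exists_descending_chain.1 hacc
  have hrun (k : ℕ) : ∃ rs, Run T φ n (.running {q} ρ σ) rs (f k) ∧ rs.length = k := by
    induction k with
    | zero => exact ⟨[], hf₀ ▸ .nil, rfl⟩
    | succ k ih =>
      obtain ⟨rs, hr, hlen⟩ := ih
      obtain ⟨r, hstep⟩ := hf k
      exact ⟨rs ++ [r], hr.snoc hstep, by simp [hlen]⟩
  obtain ⟨rs, hr, hlen⟩ := hrun _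
  exact (Nat.lt_succ_of_le (hr.length_le_workBound hq)).ne hlen

/-- The results returned by `BndSafety` are those justified by the final assertion maps. -/
def State.ResultJustified (T : L.Theory) (φ : L.Formula (A.Formals A.main)) (n : ℕ) :
    A.State → Prop
  | .running _ _ _ => True
  | .resUnsafe ρ _ => ¬ T ⊨ᵇ (underEnv ρ n A.main).imp φ
  | .resSafe _ σ => T ⊨ᵇ (overEnv σ n A.main).imp φ

/-- The invariant of the executions of `BndSafety` with bound `n`. -/
structure State.Inv (T : L.Theory) (φ : L.Formula (A.Formals A.main)) (n : ℕ) (s : A.State) :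
    Prop where
  soundMaps : SoundMaps T n s.under s.over
  bound_le : ∀ q ∈ s.queries, q.bound ≤ n
  main_open_or_answered : (⟨A.main, ∼φ, n⟩ : A.Triple) ∈ s.queries ∨
    Answered T s.under s.over ⟨A.main, ∼φ, n⟩
  resultJustified : s.ResultJustified T φ n

theorem inv_init {ρ σ : A.AMap} (h : SoundMaps T n ρ σ) : (init φ n ρ σ).Inv T φ n :=
  ⟨h, fun _ hq => (Set.mem_singleton_iff.1 hq) ▸ le_rfl, .inl rfl, trivial⟩

theorem BndStep.inv {s s' : A.State} (h : BndStep T φ n s s') (hs : s.Inv T φ n) :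
    s'.Inv T φ n := by
  obtain ⟨r, h⟩ := h
  refine ⟨h.soundMaps hs.soundMaps hs.bound_le, fun q hq => ?_, ?_, ?_⟩
  · rcases h.mem_queries_or_created hq with hq | ⟨q₀, rfl⟩
    · exact hs.bound_le q hq
    · obtain ⟨_, _, -, hb, rfl⟩ := h.exists_callSite
      have hb₀ := hs.bound_le q₀ (h.mem_queries_of_on rfl)
      exact Nat.le_of_succ_le (hb.ge.trans hb₀)
  · exact hs.main_open_or_answered.elim h.mem_queries_or_answered
      fun ha => .inr (ha.mono h.under_subset h.over_subset)
  · cases h with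
    | resUnsafe _ _ reached => exact reached
    | resSafe _ _ blocked => exact blocked
    | _ => trivial

theorem State.Inv.of_reflTransGen {s₀ s : A.State} (hs : s₀.Inv T φ n)
    (h : Relation.ReflTransGen (BndStep T φ n) s₀ s) : s.Inv T φ n := by
  induction h with
  | refl => exact hs
  | tail _ hstep ih => exact hstep.inv ih

theorem exists_step_of_answered {ρ σ : A.AMap} (h : Answered T ρ σ ⟨A.main, ∼φ, n⟩) :
    ∃ s', BndStep T φ n (.running ∅ ρ σ) s' := by
  rcases h with hblocked | hreached
  · exact ⟨_, _, .resSafe ρ σ (models_imp_iff.2 fun I x hx => not_not.1 (hblocked I x hx))⟩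
  · exact ⟨_, _, .resUnsafe ρ σ fun hm => hreached fun I x hx =>
      not_not.2 (models_imp_iff.1 hm I x hx)⟩

theorem State.Inv.exists_step_or_isFinal {s : A.State} (hs : s.Inv T φ n) :
    (∃ s', BndStep T φ n s s') ∨ s.IsFinal := by
  cases s with
  | resUnsafe => exact .inr trivial
  | resSafe => exact .inr trivial
  | running Q ρ σ =>
    rcases Q.eq_empty_or_nonempty with rfl | hQ
    · exact .inl (exists_step_of_answered
        (hs.main_open_or_answered.resolve_left (Set.notMem_empty _)))
    · exact .inl (exists_step_of_nonempty hQ)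

theorem not_exists_chain_of_acc {α : Type*} {step : α → α → Prop} {s₀ : α}
    (h : Acc (fun s' s => step s s') s₀) :
    ¬ ∃ s : ℕ → α, s 0 = s₀ ∧ ∀ i, step (s i) (s (i + 1)) :=
  fun hc => not_acc_iff_exists_descending_chain.2 hc h

theorem terminates_bndSafety (T : L.Theory) (φ : L.Formula (A.Formals A.main)) (n : ℕ) :
    Terminates (BndStep T φ n) (init φ n ∅ ∅) State.IsFinal :=
  ⟨not_exists_chain_of_acc (acc_bndStep (unreached_empty _)), fun _ hs hstuck =>
    ((inv_init .empty).of_reflTransGen hs).exists_step_or_isFinal.resolve_left hstuck⟩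

theorem IsTrace.length_le_pow {rs : List A.RuleApp} {f : ℕ → A.State} (h : IsTrace T φ n f rs)
    (hf₀ : f 0 = init φ n ∅ ∅) :
    rs.length ≤ 4 * max n 1 * max A.maxCalls 1 ^ n *
      max (A.numProcs * A.maxPaths) 1 ^ (4 * n ^ 2) := by
  have hlen := h.length_le (q₀ := ⟨A.main, ∼φ, n⟩) (by rw [hf₀]; rfl)
  have hwork := h.work_le (by rw [hf₀]; rfl) ⟨A.main, ∼φ, n⟩
  have hpos : 0 < max n 1 * max A.maxCalls 1 ^ n *
      max (A.numProcs * A.maxPaths) 1 ^ (4 * n ^ 2) := by positivity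
  simp only [mul_assoc] at hpos hwork ⊢
  omega

/-! ### Co-semidecision by `RecMC` -/

/-- The invariant of the executions of `RecMC`. -/
def RecState.Inv (T : L.Theory) (φ : L.Formula (A.Formals A.main)) : A.RecState → Prop
  | .bnd n s => s.Inv T φ n
  | .retUnsafe ρ => ∃ n σ, SoundMaps T n ρ σ ∧ ¬ T ⊨ᵇ (underEnv ρ n A.main).imp φ
  | .retSafe _ => A.Satisfies T φ

theorem RecStep.inv {s s' : A.RecState} (h : RecStep T φ s s') (hs : s.Inv T φ) :
    s'.Inv T φ := by
  cases h with
  | inner n s s' h => exact h.inv hs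
  | retUnsafe n ρ σ => exact ⟨n, σ, hs.soundMaps, hs.resultJustified⟩
  | retSafe n ρ σ h => exact hs.soundMaps.satisfies_of_isInductive hs.resultJustified h
  | next n ρ σ h => exact inv_init hs.soundMaps.push

theorem inv_of_reflTransGen_recInit {s : A.RecState}
    (h : Relation.ReflTransGen (RecStep T φ) (recInit φ) s) : s.Inv T φ := by
  induction h with
  | refl => exact inv_init .empty
  | tail _ hstep ih => exact hstep.inv ih

theorem acc_recStep_bnd {s : A.State} (hs : Acc (fun s' s => BndStep T φ n s s') s)
    (hinv : s.Inv T φ n)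
    (hnext : ∀ ρ σ : A.AMap, (State.resSafe ρ σ).Inv T φ n →
      Acc (fun s' s => RecStep T φ s s') (.bnd (n + 1) (init φ (n + 1) ρ (push T σ n)))) :
    Acc (fun s' s => RecStep T φ s s') (.bnd n s) := by
  induction hs with
  | intro s _ ih =>
    refine .intro _ fun s' h => ?_
    cases h with
    | inner _ _ s' h => exact ih s' h (h.inv hinv)
    | retUnsafe => exact .intro _ fun _ h => by cases h
    | retSafe => exact .intro _ fun _ h => by cases h
    | next _ ρ σ => exact hnext ρ σ hinv

theorem acc_recStep {k : ℕ} {I : Theory.ModelType.{u, v, max u v} T} {x : A.Formals A.main → I}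
    (hx : x ∈ A.boundedSem I (n + k) A.main) (hφ : ¬ φ.Realize x) {ρ σ : A.AMap}
    (hmaps : SoundMaps T n ρ σ) (hq : Unreached T ρ ⟨A.main, ∼φ, n⟩) :
    Acc (fun s' s => RecStep T φ s s') (.bnd n (init φ n ρ σ)) := by
  induction k generalizing n ρ σ with
  | zero =>
    -- `BndSafety` cannot return `SAFE` at the bound of the counterexample.
    refine acc_recStep_bnd (acc_bndStep hq) (inv_init hmaps) fun ρ' σ' h => absurd ?_ hφ
    exact models_imp_iff.1 h.resultJustified I x (h.soundMaps.le_interp_overEnv I n _ hx)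
  | succ k ih =>
    exact acc_recStep_bnd (acc_bndStep hq) (inv_init hmaps) fun ρ' σ' h =>
      ih (by rwa [Nat.succ_add_eq_add_succ]) h.soundMaps.push
        (h.soundMaps.unreached_succ h.resultJustified)

theorem exists_recStep_bnd {s : A.State} (hs : s.Inv T φ n) :
    ∃ s', RecStep T φ (.bnd n s) s' := by
  rcases hs.exists_step_or_isFinal with ⟨s', hs'⟩ | hfinal
  · exact ⟨_, .inner n s s' hs'⟩
  · cases s with
    | running => exact absurd hfinal id
    | resUnsafe ρ σ => exact ⟨_, .retUnsafe n ρ σ⟩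
    | resSafe ρ σ =>
      by_cases hind : IsInductive T σ n
      · exact ⟨_, .retSafe n ρ σ hind⟩
      · exact ⟨_, .next n ρ σ hind⟩

theorem terminates_recMC (h : ¬ A.Satisfies T φ) :
    Terminates (RecStep T φ) (recInit φ) RecState.IsUnsafe := by
  constructor
  · simp only [Satisfies, not_forall] at h
    obtain ⟨I, x, hx, hφ⟩ := h
    obtain ⟨b, hb⟩ := mem_sem_iff.1 hx
    exact not_exists_chain_of_acc
      (acc_recStep (k := b) (by rwa [Nat.zero_add]) hφ .empty (unreached_empty _))
  · intro s hs hstuck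
    have hinv := inv_of_reflTransGen_recInit hs
    cases s with
    | retUnsafe => trivial
    | retSafe => exact absurd hinv h
    | bnd n s => exact absurd (exists_recStep_bnd hinv) hstuck

theorem counterexample_of_retUnsafe {ρ : A.AMap}
    (h : Relation.ReflTransGen (RecStep T φ) (recInit φ) (.retUnsafe ρ)) :
    ∃ (δ : L.Formula (A.Formals A.main)) (b : ℕ), (⟨A.main, δ, b⟩ : A.Triple) ∈ ρ ∧
      ∃ (I : Theory.ModelType.{u, v, max u v} T) (x : A.Formals A.main → I),
        δ.Realize x ∧ x ∈ A.boundedSem I b A.main ∧ x ∈ A.sem I A.main ∧ ¬ φ.Realize x := by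
  obtain ⟨n, σ, hmaps, hreached⟩ := inv_of_reflTransGen_recInit h
  simp only [models_imp_iff, not_forall] at hreached
  obtain ⟨I, x, hx, hφ⟩ := hreached
  obtain ⟨δ, b, -, hδ, hδx⟩ := mem_underEnv.1 hx
  have hb := hmaps.reachable _ hδ I x hδx
  exact ⟨δ, b, hδ, I, x, hδx, hb, mem_sem_iff.2 ⟨b, hb⟩, hφ⟩

end Soundness

end Program

end RecMC

open FirstOrder FirstOrder.Language RecMC RecMC.Program in
theorem theorem2 :
    ∃ K : ℕ, ∀ (L : FirstOrder.Language.{u, v}) (T : L.Theory) (A : Program L)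
      (φ : L.Formula (A.Formals A.main)),
      -- `BndSafety(A, φ, n, ∅, ∅)` terminates, with bounds on the rule applications
      (∀ n : ℕ,
        Terminates (BndStep T φ n) (init φ n ∅ ∅) State.IsFinal ∧
        ∀ (rs : List A.RuleApp) (s : A.State), Run T φ n (init φ n ∅ ∅) rs s →
          (∀ (P : A.Proc) (b : ℕ),
            numReach rs P b ≤ A.maxPaths * (A.numProcs * A.maxPaths + 1) ^ b) ∧
          (∀ q : A.Triple,
            numQuery rs q ≤
              A.maxCalls * A.maxPaths * (A.numProcs * A.maxPaths + 1) ^ q.bound) ∧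
          (∀ q : A.Triple,
            work rs q ≤ K * max q.bound 1 * max A.maxCalls 1 ^ q.bound *
              max (A.numProcs * A.maxPaths) 1 ^ (K * q.bound ^ 2)) ∧
          rs.length ≤ K * max n 1 * max A.maxCalls 1 ^ n *
            max (A.numProcs * A.maxPaths) 1 ^ (K * n ^ 2)) ∧
      -- if there is a counterexample, then every execution of `RecMC` returns `UNSAFE`
      (¬ A.Satisfies T φ → Terminates (RecStep T φ) (recInit φ) RecState.IsUnsafe) ∧
      -- whenever `RecMC` returns `UNSAFE, ρ`, a fact in `ρ` yields an actual counterexample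
      (∀ ρ : A.AMap, Relation.ReflTransGen (RecStep T φ) (recInit φ) (.retUnsafe ρ) →
        ∃ (δ : L.Formula (A.Formals A.main)) (b : ℕ), (⟨A.main, δ, b⟩ : A.Triple) ∈ ρ ∧
          ∃ (I : Theory.ModelType.{u, v, max u v} T) (x : A.Formals A.main → I),
            δ.Realize x ∧ x ∈ A.boundedSem I b A.main ∧ x ∈ A.sem I A.main ∧
              ¬ φ.Realize x) := by
  refine ⟨4, fun L T A φ => ⟨fun n => ⟨terminates_bndSafety T φ n, fun rs s hrun => ?_⟩,
    terminates_recMC, fun ρ => counterexample_of_retUnsafe⟩⟩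
  obtain ⟨f, hf₀, hf⟩ := hrun.exists_isTrace_of_singleton (unreached_empty _)
  have hempty : (f 0).under = ∅ := by rw [hf₀]; rfl
  exact ⟨hf.numReach_le hempty, hf.numQuery_le,
    fun q => (hf.work_le hempty q).trans (by gcongr; omega), hf.length_le_pow hf₀⟩
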